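/- Let $\mathcal G=(\mathcal V,\mathcal E)$ be a finite, connected, directed graph without loops (parallel edges are allowed). Identify each edge $e$ with an interval $[0,\ell^e]$, $\ell^e>0$, where $0$ corresponds to the start vertex and $\ell^e$ to the end vertex of $e$, and put $n^e(v)=-1$ if $v$ is the start vertex of $e$, $n^e(v)=1$ if $v$ is its end vertex, and $n^e(v)=0$ otherwise. Let $\mathcal E(v)$ be the set of edges having $v$ as a vertex, $\mathcal V_0=\{v:|\mathcal E(v)|\ge 2\}$ and $\mathcal V_\partial=\mathcal V\setminus\mathcal V_0$. Let $L^2(\mathcal E)=\prod_{e} L^2(0,\ell^e)$ and $H^1_{pw}(\mathcal E)=\prod_e H^1(0,\ell^e)$ with their canonical norms; for $u\in H^1_{pw}(\mathcal E)$ and $e\in\mathcal E(v)$, $u^e(v)$ denotes the value of the continuous representative of $u^e$ at the end point of $e$ corresponding to $v$. Let $a\in H^1_{pw}(\mathcal E)$ with $a\ge a_0$ for a constant $a_0>0$, and let $b=(b^e)_{e\in\mathcal E}$ be real constants with $\sum_{e\in\mathcal E(v)}b^en^e(v)=0$ for all $v\in\mathcal V_0$, such that every vertex lies on an edge $e$ with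 $b^e\neq 0$ (in particular this holds if there is at least one edge and all $b^e\ne0$). Put $\mathcal E^{in}(v)=\{e: b^en^e(v)>0\}$, $\mathcal E^{out}(v)=\{e: b^en^e(v)<0\}$, and let $\mathcal V_\partial^{in}$ (resp. $\mathcal V_\partial^{out}$) be the set of $v\in\mathcal V_\partial$ with $b^en^e(v)<0$ (resp. $>0$) for the edge $e\in\mathcal E(v)$. Let $T>0$, $u_0\in H^1_{pw}(\mathcal E)$ and $g\in H^2(0,T;\mathbb R^{\mathcal V_\partial^{in}})$. Consider the transport problem $$a^e\,\partial_t u^e+\partial_x(b^eu^e)=0 \ \text{ on } e\in\mathcal E,\ 0<t\le T,\qquad u(0)=u_0, \tag{1}$$ $$u^e(v,t)=\hat u^v(t)\quad\text{for all } v\in\mathcal V,\ e\in\mathcal E^{out}(v),\ 0<t\le T, \tag{2}$$ $$\hat u^v(t)=g^v(t)\quad\text{for all } v\in\mathcal V_\partial^{in},\ 0\le t\le T, \tag{3}$$ $$\sum_{e\in\mathcal E^{in}(v)}b^en^e(v)\,\hat u^v(t)=\sum_{e\in\mathcal E^{in}(v)}b^en^e(v)\,u^e(v,t)\quad\text{for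 all } v\in\mathcal V_0\cup\mathcal V_\partial^{out},\ 0\le t\le T. \tag{4}$$ Assume that $u_0$ and $g(0)$ satisfy (2)–(4) at $t=0$ with some $\hat u_0\in\mathbb R^{\mathcal V}$ in place of $\hat u(0)$. Then (1)–(4) has a unique solution $u\in C^1([0,T];L^2(\mathcal E))\cap C^0([0,T];H^1_{pw}(\mathcal E))$, $\hat u\in C^0([0,T];\mathbb R^{\mathcal V})$, and $\hat u(0)=\hat u_0$. Moreover, for all $t\in[0,T]$ (with one-sided derivatives at $t=0$ and $t=T$), with $e$ denoting the edge at $v$ in the sums over boundary vertices, $$\frac{d}{dt}\int_{\mathcal E}a\,u(x,t)\,dx=-\sum_{v\in\mathcal V_\partial}b^en^e(v)\,u^e(v,t),$$ $$\frac{d}{dt}\|a^{1/2}u(t)\|^2_{L^2(\mathcal E)}=-\sum_{v\in\mathcal V_\partial^{out}}|b^en^e(v)|\,|u^e(v,t)|^2+\sum_{v\in\mathcal V_\partial^{in}}|b^en^e(v)|\,|g^v(t)|^2-\sum_{v\in\mathcal V_0}\sum_{e\in\mathcal E^{in}(v)}|b^en^e(v)|\,|u^e(v,t)-\hat u^v(t)|^2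 .$$ -/

import Mathlib

open MeasureTheory Set
open scoped ContDiff

noncomputable section

namespace TransportNetwork

/-! Sobolev spaces on an interval `(0, L)`. -/

/-- The Lebesgue space `L²(0, L)`. -/
abbrev L2 (L : ℝ) : Type := Lp ℝ 2 (volume.restrict (Ioo (0 : ℝ) L))

/-- Smooth functions with compact support in `(0, L)`. -/
structure IsTest (L : ℝ) (φ : ℝ → ℝ) : Prop where
  smooth : ContDiff ℝ ∞ φ
  compact : HasCompactSupport φ
  supp : tsupport φ ⊆ Ioo 0 L

/-- `g ∈ L²(0, L)` is the weak derivative of `f ∈ L²(0, L)`. -/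
def HasWeakDeriv {L : ℝ} (f g : L2 L) : Prop :=
  ∀ φ : ℝ → ℝ, IsTest L φ →
    ∫ x in Ioo 0 L, f x * deriv φ x = - ∫ x in Ioo 0 L, g x * φ x

theorem IsTest.deriv_continuous {L : ℝ} {φ : ℝ → ℝ} (h : IsTest L φ) : Continuous (deriv φ) :=
  h.smooth.continuous_deriv (by simp)

theorem integrable_mul_of_compact {L : ℝ} (f : L2 L) {ψ : ℝ → ℝ} (hc : Continuous ψ)
    (hs : HasCompactSupport ψ) :
    Integrable (fun x => f x * ψ x) (volume.restrict (Ioo (0 : ℝ) L)) :=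
  MemLp.integrable_mul (p := 2) (q := 2) (Lp.memLp f)
    ((hc.memLp_of_hasCompactSupport hs).restrict _)

theorem HasWeakDeriv.add {L : ℝ} {f g f' g' : L2 L} (h : HasWeakDeriv f g)
    (h' : HasWeakDeriv f' g') : HasWeakDeriv (f + f') (g + g') := by
  intro φ hφ
  have e1 : ∫ x in Ioo 0 L, (f + f') x * deriv φ x
      = ∫ x in Ioo 0 L, (f x * deriv φ x + f' x * deriv φ x) := by
    apply integral_congr_ae
    filter_upwards [Lp.coeFn_add f f'] with x hx
    rw [hx, Pi.add_apply, add_mul]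
  have e2 : ∫ x in Ioo 0 L, (g + g') x * φ x
      = ∫ x in Ioo 0 L, (g x * φ x + g' x * φ x) := by
    apply integral_congr_ae
    filter_upwards [Lp.coeFn_add g g'] with x hx
    rw [hx, Pi.add_apply, add_mul]
  have hd := hφ.deriv_continuous
  have hs := hφ.compact.deriv
  rw [e1, e2, integral_add (integrable_mul_of_compact f hd hs)
    (integrable_mul_of_compact f' hd hs),
    integral_add (integrable_mul_of_compact g hφ.smooth.continuous hφ.compact)
    (integrable_mul_of_compact g' hφ.smooth.continuous hφ.compact), h φ hφ, h' φ hφ]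
  ring

theorem HasWeakDeriv.smul {L : ℝ} {f g : L2 L} (c : ℝ) (h : HasWeakDeriv f g) :
    HasWeakDeriv (c • f) (c • g) := by
  intro φ hφ
  have e1 : ∫ x in Ioo 0 L, (c • f) x * deriv φ x
      = ∫ x in Ioo 0 L, c * (f x * deriv φ x) := by
    apply integral_congr_ae
    filter_upwards [Lp.coeFn_smul c f] with x hx
    rw [hx, Pi.smul_apply, smul_eq_mul, mul_assoc]
  have e2 : ∫ x in Ioo 0 L, (c • g) x * φ x = ∫ x in Ioo 0 L, c * (g x * φ x) := by
    apply integral_congr_ae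
    filter_upwards [Lp.coeFn_smul c g] with x hx
    rw [hx, Pi.smul_apply, smul_eq_mul, mul_assoc]
  rw [e1, e2, integral_const_mul, integral_const_mul, h φ hφ]
  ring

theorem HasWeakDeriv.zero {L : ℝ} : HasWeakDeriv (0 : L2 L) 0 := by
  intro φ _
  have e : ∀ ψ : ℝ → ℝ, ∫ x in Ioo 0 L, (0 : L2 L) x * ψ x = 0 := by
    intro ψ
    apply integral_eq_zero_of_ae
    filter_upwards [Lp.coeFn_zero ℝ 2 (volume.restrict (Ioo (0 : ℝ) L))] with x hx
    rw [hx]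
    simp
  rw [e, e, neg_zero]

/-- The Sobolev space `H¹(0, L)`: pairs `(u, u')` of an `L²` function and its (unique) weak
derivative in `L²`, with the norm `‖u‖² = ‖u‖²_{L²} + ‖u'‖²_{L²}` inherited from the product. -/
def H1Submodule (L : ℝ) : Submodule ℝ (WithLp 2 (L2 L × L2 L)) where
  carrier := {p | HasWeakDeriv p.fst p.snd}
  add_mem' := fun h h' => HasWeakDeriv.add h h'
  zero_mem' := HasWeakDeriv.zero
  smul_mem' := fun c _ h => HasWeakDeriv.smul c h

/-- The Sobolev space `H¹(0, L)` as a normed space. -/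
abbrev H1 (L : ℝ) : Type := H1Submodule L

/-- The function `u ∈ L²(0, L)` underlying an element of `H¹(0, L)`. -/
def H1.toL2 {L : ℝ} (u : H1 L) : L2 L := u.1.fst

/-- The weak derivative of an element of `H¹(0, L)`. -/
def H1.wderiv {L : ℝ} (u : H1 L) : L2 L := u.1.snd

/-- The representative of `u ∈ H¹(0, L)` that is continuous on `[0, L]`. Its values on `[0, L]`,
the end points included, do not depend on any choice. -/
def H1.rep {L : ℝ} (u : H1 L) : ℝ → ℝ :=
  Classical.epsilon fun U : ℝ → ℝ =>
    ContinuousOn U (Icc 0 L) ∧ u.toL2 =ᵐ[volume.restrict (Ioo (0 : ℝ) L)] U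

/-- Membership in `H²(0, L)`: the weak derivative lies in `H¹(0, L)`. -/
def H1.IsH2 {L : ℝ} (u : H1 L) : Prop := ∃ w : H1 L, w.toL2 = u.wderiv

/-- A directed graph with vertices `V` and edges `E`, without loops. The edge `e` runs from `src e`
to `tgt e` and is identified with the interval `[0, len e]`. -/
structure Network (V E : Type*) where
  src : E → V
  tgt : E → V
  src_ne_tgt : ∀ e, src e ≠ tgt e
  len : E → ℝ
  len_pos : ∀ e, 0 < len e

namespace Network

variable {V E : Type*} [Fintype V] [DecidableEq V] [Fintype E] (N : Network V E)

/-- The underlying undirected graph is connected. -/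
def Connected {V E : Type*} (N : Network V E) : Prop :=
  (SimpleGraph.fromRel fun v w => ∃ e, N.src e = v ∧ N.tgt e = w).Connected

/-- The edges incident to `v`. -/
def edgesAt (v : V) : Finset E := {e | N.src e = v ∨ N.tgt e = v}

/-- Inner vertices (junctions). -/
def inner : Finset V := {v | 2 ≤ (N.edgesAt v).card}

/-- Boundary vertices. -/
def boundary : Finset V := Finset.univ \ N.inner

/-- `n^e(v)`: `-1` at the start, `1` at the end of `e`, and `0` at all other vertices. -/
def normal (e : E) (v : V) : ℝ := if v = N.src e then -1 else if v = N.tgt e then 1 else 0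

/-- Edges with flow into the vertex `v`. -/
def edgesIn (b : E → ℝ) (v : V) : Finset E := {e | 0 < b e * N.normal e v}

/-- Edges with flow out of the vertex `v`. -/
def edgesOut (b : E → ℝ) (v : V) : Finset E := {e | b e * N.normal e v < 0}

/-- Inflow vertices. -/
def inflow (b : E → ℝ) : Finset V :=
  {v ∈ N.boundary | ∀ e ∈ N.edgesAt v, b e * N.normal e v < 0}

/-- Outflow vertices. -/
def outflow (b : E → ℝ) : Finset V :=
  {v ∈ N.boundary | ∀ e ∈ N.edgesAt v, 0 < b e * N.normal e v}

/-- `L²` of the network. -/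
abbrev L2net : Type _ := PiLp 2 fun e : E => L2 (N.len e)

/-- The broken Sobolev space `H¹_pw` of the network. -/
abbrev H1pw : Type _ := PiLp 2 fun e : E => H1 (N.len e)

/-- The embedding of `H¹_pw` into `L²`. -/
def toL2net (u : N.H1pw) : N.L2net := WithLp.toLp 2 fun e => (u e).toL2

/-- The value `u^e(v)` at an end point `v` of the edge `e`. -/
def val (u : N.H1pw) (e : E) (v : V) : ℝ := (u e).rep (if v = N.tgt e then N.len e else 0)

/-- Edges with flow out of a vertex take the vertex value there. -/
def OutCond (b : E → ℝ) (u : N.H1pw) (uhat : V → ℝ) : Prop :=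
  ∀ v, ∀ e ∈ N.edgesOut b v, N.val u e v = uhat v

/-- The vertex values at inflow vertices are prescribed. -/
def InflowCond (b : E → ℝ) (g : N.inflow b → ℝ) (uhat : V → ℝ) : Prop :=
  ∀ v : N.inflow b, uhat v = g v

/-- The mixing condition at junctions and outflow vertices. -/
def MixCond (b : E → ℝ) (u : N.H1pw) (uhat : V → ℝ) : Prop :=
  ∀ v ∈ N.inner ∪ N.outflow b,
    ∑ e ∈ N.edgesIn b v, b e * N.normal e v * uhat v
      = ∑ e ∈ N.edgesIn b v, b e * N.normal e v * N.val u e v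

/-- `(u, uhat)` is a solution on `[0, T]`, with
`u ∈ C¹([0,T]; L²) ∩ C⁰([0,T]; H¹_pw)` and `uhat ∈ C⁰([0,T]; ℝ^V)`, of the transport problem with
cross sections `a`, flow rates `b`, initial values `u₀` and inflow values `g`. -/
structure IsSolution (a : N.H1pw) (b : E → ℝ) (T : ℝ) (u₀ : N.H1pw) (g : N.inflow b → H1 T)
    (u : ℝ → N.H1pw) (uhat : ℝ → V → ℝ) : Prop where
  contDiff_L2 : ContDiffOn ℝ 1 (fun t => N.toL2net (u t)) (Icc 0 T)
  continuous_H1 : ContinuousOn u (Icc 0 T)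
  continuous_uhat : ContinuousOn uhat (Icc 0 T)
  transport : ∀ t ∈ Ioc 0 T, ∀ e, ∀ᵐ x ∂(volume.restrict (Ioo 0 (N.len e))),
    (a e).toL2 x * (derivWithin (fun s => N.toL2net (u s)) (Icc 0 T) t) e x
      + (b e • u t e : H1 (N.len e)).wderiv x = 0
  initial : u 0 = u₀
  out_cond : ∀ t ∈ Ioc 0 T, N.OutCond b (u t) (uhat t)
  inflow_cond : ∀ t ∈ Icc 0 T, N.InflowCond b (fun v => (g v).rep t) (uhat t)
  mix_cond : ∀ t ∈ Icc 0 T, N.MixCond b (u t) (uhat t)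

/-- The total mass `∫ a u dx`. -/
def mass (a u : N.H1pw) : ℝ :=
  ∑ e, ∫ x in Ioo 0 (N.len e), (a e).toL2 x * (u e).toL2 x

/-- The energy `‖a^{1/2} u‖²` in `L²` of the network. -/
def energy (a u : N.H1pw) : ℝ :=
  ∑ e, ∫ x in Ioo 0 (N.len e), (Real.sqrt ((a e).toL2 x) * (u e).toL2 x) ^ 2

end Network

end TransportNetwork

end

open TransportNetwork

/-! The proof follows characteristics. On an edge with `b e ≠ 0` let `κ` be the travel time from the
point of entry, so that `a = b κ'`. Every function `u(x,t) = f(t - κ x)` then satisfies `a ∂ₜu + b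
∂ₓu = 0`, where `f s` is the value entering the edge at time `s`. For `s ≤ 0` the signal `f` encodes
the initial values; for `s > 0` it is the value at the upstream vertex. Edges with `b e = 0` keep
their initial values.

Existence thus reduces to finding the vertex values. The mixing condition expresses each of them,
away from the inflow vertices, as a weighted mean of incoming signals at times `t - τ e`, where `τ e
> 0` is the travel time through the edge. There are finitely many edges, so the delays have a
positive lower bound and the method of steps solves the system (`exists_delay_solution`). The
compatibility of the data at time zero makes the two pieces of each signal match, so that it is
absolutely continuous with derivative in `L²` (`HasL2Deriv.glue`). Continuity of translation in `L²`
turns this into the required regularity in time (`hasDerivAt_edgeFlow`, `continuous_edgeFlow`).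

The balance laws come from integration by parts on each edge and regrouping the end point terms by
vertices (`sum_flux_eq`, `sum_flux_sq_eq`). At a junction, conservation of flow and the mixing
condition cancel the mass terms and leave a sum of squares in the energy. Applied to the difference
of two solutions, for which the inflow term vanishes, the energy balance gives uniqueness
(`IsSolution.unique`). -/

namespace TransportNetwork

/-! ### Absolutely continuous functions on the line with derivative in `L¹ ∩ L²`. -/

/-- `ψ ∈ L¹(ℝ) ∩ L²(ℝ)` is the derivative of the absolutely continuous function `f`. -/
structure HasL2Deriv (f ψ : ℝ → ℝ) : Prop where
  meas : Measurable ψ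
  integrable : Integrable ψ
  memLp : MemLp ψ 2
  integral_eq : ∀ x y, ∫ t in x..y, ψ t = f y - f x

namespace HasL2Deriv

variable {f ψ f₁ ψ₁ f₂ ψ₂ : ℝ → ℝ}

theorem intervalIntegrable (h : HasL2Deriv f ψ) (x y : ℝ) : IntervalIntegrable ψ volume x y :=
  h.integrable.intervalIntegrable

theorem eq_add_integral (h : HasL2Deriv f ψ) (x : ℝ) : f = fun y => f x + ∫ t in x..y, ψ t := by
  funext y
  rw [h.integral_eq]
  ring

theorem continuous (h : HasL2Deriv f ψ) : Continuous f := by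
  rw [h.eq_add_integral 0]
  exact continuous_const.add (intervalIntegral.continuous_primitive h.intervalIntegrable 0)

theorem const (c : ℝ) : HasL2Deriv (fun _ => c) 0 :=
  ⟨measurable_zero, integrable_zero _ _ _, MemLp.zero, by simp⟩

theorem add (h₁ : HasL2Deriv f₁ ψ₁) (h₂ : HasL2Deriv f₂ ψ₂) :
    HasL2Deriv (fun x => f₁ x + f₂ x) (ψ₁ + ψ₂) where
  meas := h₁.meas.add h₂.meas
  integrable := h₁.integrable.add h₂.integrable
  memLp := h₁.memLp.add h₂.memLp
  integral_eq x y := by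
    simp only [Pi.add_apply]
    rw [intervalIntegral.integral_add (h₁.intervalIntegrable x y) (h₂.intervalIntegrable x y),
      h₁.integral_eq, h₂.integral_eq]
    ring

theorem const_mul (c : ℝ) (h : HasL2Deriv f ψ) :
    HasL2Deriv (fun x => c * f x) (fun x => c * ψ x) where
  meas := h.meas.const_mul c
  integrable := h.integrable.const_mul c
  memLp := h.memLp.const_mul c
  integral_eq x y := by
    rw [intervalIntegral.integral_const_mul, h.integral_eq]
    ring

theorem exists_sum {ι : Type*} (s : Finset ι) (F : ι → ℝ → ℝ)
    (h : ∀ i ∈ s, ∃ ψ, HasL2Deriv (F i) ψ) : ∃ ψ, HasL2Deriv (fun x => ∑ i ∈ s, F i x) ψ := by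
  classical
  induction s using Finset.induction_on with
  | empty => exact ⟨0, by simpa using const 0⟩
  | insert i s hi ih =>
    obtain ⟨ψ₁, h₁⟩ := h i (Finset.mem_insert_self _ _)
    obtain ⟨ψ₂, h₂⟩ := ih fun j hj => h j (Finset.mem_insert_of_mem hj)
    refine ⟨ψ₁ + ψ₂, ?_⟩
    simp only [Finset.sum_insert hi]
    exact h₁.add h₂

theorem absolutelyContinuousOnInterval (h : HasL2Deriv f ψ) (x y : ℝ) :
    AbsolutelyContinuousOnInterval f x y := by
  rw [h.eq_add_integral x]
  have h1 : AbsolutelyContinuousOnInterval (fun _ : ℝ => f x) x y :=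
    (contDiff_const (n := 1)).contDiffOn.absolutelyContinuousOnInterval
  exact h1.add
    ((h.intervalIntegrable x y).absolutelyContinuousOnInterval_intervalIntegral left_mem_uIcc)

theorem ae_hasDerivAt (h : HasL2Deriv f ψ) (x y : ℝ) :
    ∀ᵐ t, t ∈ uIcc x y → HasDerivAt f (ψ t) t := by
  filter_upwards [(h.intervalIntegrable x y).ae_hasDerivAt_integral] with t ht hmem
  have := (ht hmem x left_mem_uIcc).const_add (f x)
  rwa [h.eq_add_integral x]

/-- The product rule for absolutely continuous functions. It yields both the weak derivative of `f`
and the energy identity on an edge. -/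
theorem integral_mul_add_mul (h₁ : HasL2Deriv f₁ ψ₁) (h₂ : HasL2Deriv f₂ ψ₂) (x y : ℝ) :
    ∫ t in x..y, ψ₁ t * f₂ t + f₁ t * ψ₂ t = f₁ y * f₂ y - f₁ x * f₂ x := by
  rw [← AbsolutelyContinuousOnInterval.integral_deriv_mul_eq_sub
    (h₁.absolutelyContinuousOnInterval x y) (h₂.absolutelyContinuousOnInterval x y)]
  apply intervalIntegral.integral_congr_ae
  filter_upwards [h₁.ae_hasDerivAt x y, h₂.ae_hasDerivAt x y] with t h1 h2 ht
  rw [(h1 (uIoc_subset_uIcc ht)).deriv, (h2 (uIoc_subset_uIcc ht)).deriv]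

/-- Equal values at `0` prevent a jump; the derivatives need not match there. This is where the
compatibility of initial and vertex data is used. -/
theorem glue (h₁ : HasL2Deriv f₁ ψ₁) (h₂ : HasL2Deriv f₂ ψ₂) (h0 : f₁ 0 = f₂ 0) :
    HasL2Deriv (fun x => if x ≤ 0 then f₁ x else f₂ x) (fun x => if x ≤ 0 then ψ₁ x else ψ₂ x) := by
  have hms : MeasurableSet {x : ℝ | x ≤ 0} := measurableSet_Iic
  have e : (fun x => if x ≤ 0 then ψ₁ x else ψ₂ x)
      = {x : ℝ | x ≤ 0}.indicator ψ₁ + {x : ℝ | x ≤ 0}ᶜ.indicator ψ₂ := by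
    funext x
    by_cases hx : x ≤ 0 <;> simp [hx]
  have hi : Integrable (fun x => if x ≤ 0 then ψ₁ x else ψ₂ x) := by
    rw [e]
    exact (h₁.integrable.indicator hms).add (h₂.integrable.indicator hms.compl)
  have key : ∀ y, ∫ t in (0 : ℝ)..y, (if t ≤ 0 then ψ₁ t else ψ₂ t)
      = (if y ≤ 0 then f₁ y else f₂ y) - f₁ 0 := by
    intro y
    by_cases hy : y ≤ 0
    · rw [if_pos hy, ← h₁.integral_eq]
      apply intervalIntegral.integral_congr
      intro t ht
      rw [uIcc_of_ge hy] at ht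
      simp [ht.2]
    · rw [if_neg hy, h0, ← h₂.integral_eq]
      apply intervalIntegral.integral_congr_ae
      refine Filter.Eventually.of_forall fun t ht => ?_
      rw [uIoc_of_le (le_of_not_ge hy)] at ht
      simp [ht.1]
  refine ⟨Measurable.ite hms h₁.meas h₂.meas, hi, ?_, fun x y => ?_⟩
  · rw [e]
    exact (h₁.memLp.indicator hms).add (h₂.memLp.indicator hms.compl)
  · rw [← intervalIntegral.integral_interval_sub_left (hi.intervalIntegrable (a := 0))
      hi.intervalIntegrable, key, key]
    ring

end HasL2Deriv

/-! ### Changes of variables with derivative bounded above and away from zero. -/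

/-- `κ` is a `C¹` diffeomorphism of `ℝ` onto its image, with derivative `κ'` bounded and
bounded away from zero. -/
structure IsBiLip (κ κ' : ℝ → ℝ) : Prop where
  hasDerivAt : ∀ x, HasDerivAt κ (κ' x) x
  cont : Continuous κ'
  sign : (∀ x, 0 < κ' x) ∨ (∀ x, κ' x < 0)
  lower : ∃ c, 0 < c ∧ ∀ x, c ≤ |κ' x|
  upper : ∃ C, ∀ x, |κ' x| ≤ C

namespace IsBiLip

variable {κ κ' : ℝ → ℝ}

theorem continuous (h : IsBiLip κ κ') : Continuous κ :=
  continuous_iff_continuousAt.2 fun x => (h.hasDerivAt x).continuousAt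

theorem injective (h : IsBiLip κ κ') : Function.Injective κ := by
  rcases h.sign with hs | hs
  · exact (strictMono_of_deriv_pos fun x => by rw [(h.hasDerivAt x).deriv]; exact hs x).injective
  · exact (strictAnti_of_deriv_neg fun x => by rw [(h.hasDerivAt x).deriv]; exact hs x).injective

/-- By the change of variables formula, a lower bound `c` for `|κ'|` bounds the density of the image
measure by `c⁻¹`. -/
theorem exists_map_le (h : IsBiLip κ κ') :
    ∃ K : ENNReal, K ≠ ⊤ ∧ Measure.map κ volume ≤ K • (volume : Measure ℝ) := by
  obtain ⟨c, hc, hl⟩ := h.lower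
  refine ⟨ENNReal.ofReal c⁻¹, ENNReal.ofReal_ne_top, Measure.le_iff.2 fun s hs => ?_⟩
  have h1 := lintegral_image_eq_lintegral_abs_deriv_mul MeasurableSet.univ
    (fun x _ => (h.hasDerivAt x).hasDerivWithinAt) h.injective.injOn (s.indicator 1)
  rw [Measure.map_apply h.continuous.measurable hs, Measure.smul_apply, smul_eq_mul]
  calc volume (κ ⁻¹' s) = ∫⁻ x, (κ ⁻¹' s).indicator 1 x := by
        rw [lintegral_indicator_one (h.continuous.measurable hs)]
    _ ≤ ∫⁻ x, ENNReal.ofReal c⁻¹ * (ENNReal.ofReal |κ' x| * s.indicator 1 (κ x)) := by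
        apply lintegral_mono
        intro x
        by_cases hx : κ x ∈ s
        · have : x ∈ κ ⁻¹' s := hx
          simp only [indicator_of_mem this, indicator_of_mem hx, Pi.one_apply, mul_one]
          rw [← ENNReal.ofReal_mul (by positivity), ← ENNReal.ofReal_one]
          apply ENNReal.ofReal_le_ofReal
          rw [inv_mul_eq_div, le_div_iff₀ hc, one_mul]
          exact hl x
        · have : x ∉ κ ⁻¹' s := hx
          simp [indicator_of_notMem this]
    _ = ENNReal.ofReal c⁻¹ * ∫⁻ x, ENNReal.ofReal |κ' x| * s.indicator 1 (κ x) := by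
        rw [lintegral_const_mul' _ _ ENNReal.ofReal_ne_top]
    _ ≤ ENNReal.ofReal c⁻¹ * volume s := by
        gcongr
        rw [setLIntegral_univ] at h1
        rw [← h1]
        refine (setLIntegral_le_lintegral _ _).trans ?_
        rw [lintegral_indicator_one hs]

theorem exists_eLpNorm_comp_le (h : IsBiLip κ κ') :
    ∃ K : ENNReal, K ≠ ⊤ ∧ ∀ g : ℝ → ℝ, Measurable g →
      eLpNorm (g ∘ κ) 2 volume ≤ K * eLpNorm g 2 volume := by
  obtain ⟨K, hK, hle⟩ := h.exists_map_le
  refine ⟨K ^ (1 / (2 : ENNReal)).toReal, ENNReal.rpow_ne_top_of_nonneg (by positivity) hK,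
    fun g hg => ?_⟩
  rw [← eLpNorm_map_measure hg.aestronglyMeasurable h.continuous.aemeasurable]
  refine (eLpNorm_mono_measure g hle).trans ?_
  rw [eLpNorm_smul_measure_of_ne_top (by simp)]
  simp

theorem memLp_comp (h : IsBiLip κ κ') {g : ℝ → ℝ} {p : ENNReal} (hm : Measurable g)
    (hg : MemLp g p) : MemLp (g ∘ κ) p := by
  obtain ⟨K, hK, hle⟩ := h.exists_map_le
  have := hg.of_measure_le_smul hK hle
  exact (memLp_map_measure_iff hm.aestronglyMeasurable h.continuous.aemeasurable).1 this

theorem sub_left (h : IsBiLip κ κ') (t : ℝ) :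
    IsBiLip (fun x => t - κ x) (fun x => -κ' x) where
  hasDerivAt x := (h.hasDerivAt x).const_sub t
  cont := h.cont.neg
  sign := by
    rcases h.sign with hs | hs
    · exact Or.inr fun x => by simpa using hs x
    · exact Or.inl fun x => by simpa using hs x
  lower := by simpa using h.lower
  upper := by simpa using h.upper

/-- The constant sign of `κ'` makes `κ` monotone, so substitution needs no regularity of `ψ`. -/
theorem integral_comp (h : IsBiLip κ κ') (ψ : ℝ → ℝ) (x y : ℝ) :
    ∫ t in x..y, κ' t * ψ (κ t) = ∫ s in κ x..κ y, ψ s := by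
  rcases h.sign with hs | hs
  · exact intervalIntegral.integral_deriv_smul_comp_of_deriv_nonneg h.continuous.continuousOn
      (fun t _ => h.hasDerivAt t) (fun t _ => (hs t).le)
  · exact intervalIntegral.integral_deriv_smul_comp_of_deriv_nonpos h.continuous.continuousOn
      (fun t _ => h.hasDerivAt t) (fun t _ => (hs t).le)

end IsBiLip

theorem HasL2Deriv.comp {f ψ κ κ' : ℝ → ℝ} (hf : HasL2Deriv f ψ) (h : IsBiLip κ κ') :
    HasL2Deriv (fun x => f (κ x)) (fun x => κ' x * ψ (κ x)) := by
  obtain ⟨C, hC⟩ := h.upper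
  have key : ∀ {p : ENNReal}, MemLp ψ p → MemLp (fun x => κ' x * ψ (κ x)) p := by
    intro p hp
    have h1 := (h.memLp_comp hf.meas hp).const_mul C
    refine h1.mono (h.cont.measurable.mul
      (hf.meas.comp h.continuous.measurable)).aestronglyMeasurable
      (Filter.Eventually.of_forall fun x => ?_)
    simp only [norm_mul, Real.norm_eq_abs, Function.comp]
    exact mul_le_mul_of_nonneg_right ((hC x).trans (le_abs_self C)) (abs_nonneg _)
  refine ⟨h.cont.measurable.mul (hf.meas.comp h.continuous.measurable), ?_, key hf.memLp,
    fun x y => ?_⟩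
  · exact memLp_one_iff_integrable.1 (key (memLp_one_iff_integrable.2 hf.integrable))
  · rw [h.integral_comp, hf.integral_eq]

end TransportNetwork

/-! ### Elements of `H¹(0, L)`: continuous representatives and integration by parts. -/

namespace TransportNetwork

variable {L : ℝ}

theorem IsTest.hasL2Deriv {φ : ℝ → ℝ} (h : IsTest L φ) : HasL2Deriv φ (deriv φ) where
  meas := h.deriv_continuous.measurable
  integrable := h.deriv_continuous.integrable_of_hasCompactSupport h.compact.deriv
  memLp := h.deriv_continuous.memLp_of_hasCompactSupport h.compact.deriv
  integral_eq x y := intervalIntegral.integral_deriv_eq_sub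
    (fun t _ => h.smooth.contDiffAt.differentiableAt (by simp))
    (h.deriv_continuous.intervalIntegrable _ _)

theorem IsTest.eq_zero_of_notMem {φ : ℝ → ℝ} (h : IsTest L φ) {x : ℝ} (hx : x ∉ Ioo 0 L) :
    φ x = 0 :=
  image_eq_zero_of_notMem_tsupport fun hm => hx (h.supp hm)

theorem setIntegral_Ioo_eq {f : ℝ → ℝ} (hL : 0 ≤ L) :
    ∫ x in Ioo 0 L, f x = ∫ x in (0 : ℝ)..L, f x := by
  rw [intervalIntegral.integral_of_le hL, integral_Ioc_eq_integral_Ioo]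

theorem memLp_of_continuousOn {f : ℝ → ℝ} (hf : ContinuousOn f (Icc 0 L)) (p : ENNReal) :
    MemLp f p (volume.restrict (Ioo (0 : ℝ) L)) := by
  obtain ⟨C, hC⟩ := isCompact_Icc.exists_bound_of_continuousOn hf
  refine MemLp.of_bound ((hf.mono Ioo_subset_Icc_self).aestronglyMeasurable measurableSet_Ioo) C ?_
  filter_upwards [ae_restrict_mem measurableSet_Ioo] with x hx using hC x (Ioo_subset_Icc_self hx)

theorem integrable_mul_L2 (f g : L2 L) :
    Integrable (fun x => f x * g x) (volume.restrict (Ioo (0 : ℝ) L)) :=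
  MemLp.integrable_mul (p := 2) (q := 2) (Lp.memLp f) (Lp.memLp g)

theorem integrable_L2 (f : L2 L) : Integrable f (volume.restrict (Ioo (0 : ℝ) L)) :=
  (Lp.memLp f).integrable (by norm_num)

namespace HasL2Deriv

variable {f ψ : ℝ → ℝ}

theorem memLp_restrict (h : HasL2Deriv f ψ) (L : ℝ) :
    MemLp f 2 (volume.restrict (Ioo (0 : ℝ) L)) :=
  memLp_of_continuousOn h.continuous.continuousOn 2

theorem integral_mul_deriv_test (h : HasL2Deriv f ψ) {φ : ℝ → ℝ} (hφ : IsTest L φ) :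
    ∫ x in Ioo 0 L, f x * deriv φ x = - ∫ x in Ioo 0 L, ψ x * φ x := by
  rcases lt_or_ge L 0 with hL | hL
  · simp [Ioo_eq_empty_of_le hL.le]
  · have h1 := h.integral_mul_add_mul hφ.hasL2Deriv 0 L
    rw [hφ.eq_zero_of_notMem (x := 0) (by simp), hφ.eq_zero_of_notMem (x := L) (by simp)] at h1
    rw [setIntegral_Ioo_eq hL, setIntegral_Ioo_eq hL]
    rw [intervalIntegral.integral_add] at h1
    · linarith
    · exact (h.intervalIntegrable 0 L).mul_continuousOn hφ.smooth.continuous.continuousOn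
    · exact (hφ.deriv_continuous.intervalIntegrable _ _).continuousOn_mul
        h.continuous.continuousOn

/-- The element of `H¹(0, L)` given by a globally defined function. -/
noncomputable def toH1 (h : HasL2Deriv f ψ) (L : ℝ) : H1 L :=
  ⟨WithLp.toLp 2 ((h.memLp_restrict L).toLp f, (h.memLp.restrict (Ioo 0 L)).toLp ψ), by
    intro φ hφ
    have e1 := (h.memLp_restrict L).coeFn_toLp
    have e2 := (h.memLp.restrict (Ioo 0 L)).coeFn_toLp
    calc _ = ∫ x in Ioo 0 L, f x * deriv φ x :=
          integral_congr_ae (by filter_upwards [e1] with x hx using congrArg (· * deriv φ x) hx)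
      _ = - ∫ x in Ioo 0 L, ψ x * φ x := h.integral_mul_deriv_test hφ
      _ = _ := by
          congr 1
          exact integral_congr_ae (by
            filter_upwards [e2] with x hx using (congrArg (· * φ x) hx).symm)⟩

theorem toL2_toH1_ae (h : HasL2Deriv f ψ) (L : ℝ) :
    (h.toH1 L).toL2 =ᵐ[volume.restrict (Ioo (0 : ℝ) L)] f :=
  (h.memLp_restrict L).coeFn_toLp

theorem wderiv_toH1_ae (h : HasL2Deriv f ψ) (L : ℝ) :
    (h.toH1 L).wderiv =ᵐ[volume.restrict (Ioo (0 : ℝ) L)] ψ :=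
  (h.memLp.restrict (Ioo 0 L)).coeFn_toLp

end HasL2Deriv

theorem eqOn_of_ae_eq {f g : ℝ → ℝ} (hL : 0 < L) (hf : ContinuousOn f (Icc 0 L))
    (hg : ContinuousOn g (Icc 0 L)) (h : f =ᵐ[volume.restrict (Ioo (0 : ℝ) L)] g) :
    EqOn f g (Icc 0 L) := by
  have h' : EqOn f g (Ioo 0 L) := Measure.eqOn_open_of_ae_eq h isOpen_Ioo
    (hf.mono Ioo_subset_Icc_self) (hg.mono Ioo_subset_Icc_self)
  exact h'.of_subset_closure hf hg Ioo_subset_Icc_self (by rw [closure_Ioo hL.ne])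

namespace H1

/-- A continuous function representing `u` agrees on `[0, L]` with the chosen representative. -/
theorem rep_eqOn (hL : 0 < L) (u : H1 L) {f : ℝ → ℝ} (hf : ContinuousOn f (Icc 0 L))
    (h : u.toL2 =ᵐ[volume.restrict (Ioo (0 : ℝ) L)] f) : EqOn u.rep f (Icc 0 L) := by
  have := Classical.epsilon_spec (p := fun U : ℝ → ℝ =>
    ContinuousOn U (Icc 0 L) ∧ u.toL2 =ᵐ[volume.restrict (Ioo (0 : ℝ) L)] U) ⟨f, hf, h⟩
  exact eqOn_of_ae_eq hL this.1 hf (this.2.symm.trans h)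

end H1

theorem ae_eq_zero_of_integral_test {f : ℝ → ℝ}
    (hf : Integrable f (volume.restrict (Ioo (0 : ℝ) L)))
    (h : ∀ φ, IsTest L φ → ∫ x in Ioo 0 L, f x * φ x = 0) :
    f =ᵐ[volume.restrict (Ioo (0 : ℝ) L)] 0 := by
  have := isOpen_Ioo.ae_eq_zero_of_integral_contDiff_smul_eq_zero (μ := volume)
    (U := Ioo (0 : ℝ) L) (f := f) (IntegrableOn.locallyIntegrableOn hf) ?_
  · rw [Filter.EventuallyEq, ae_restrict_iff' measurableSet_Ioo]
    exact this
  · intro g hg hc hs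
    have hT : IsTest L g := ⟨hg, hc, hs⟩
    rw [← h g hT, ← integral_indicator measurableSet_Ioo]
    congr 1
    funext x
    by_cases hx : x ∈ Ioo 0 L
    · simp [hx, mul_comm]
    · simp [hx, hT.eq_zero_of_notMem hx]

theorem HasWeakDeriv.unique {f g g' : L2 L} (h : HasWeakDeriv f g) (h' : HasWeakDeriv f g') :
    g = g' := by
  have hi : Integrable (fun x => g x - g' x) (volume.restrict (Ioo (0 : ℝ) L)) :=
    (integrable_L2 g).sub (integrable_L2 g')
  have := ae_eq_zero_of_integral_test hi fun φ hφ => by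
    have h1 := h φ hφ
    have h2 := h' φ hφ
    simp only [sub_mul]
    rw [integral_sub (integrable_mul_of_compact g hφ.smooth.continuous hφ.compact)
      (integrable_mul_of_compact g' hφ.smooth.continuous hφ.compact)]
    linarith
  apply Lp.ext
  filter_upwards [this] with x hx
  simpa [sub_eq_zero] using hx

theorem H1.ext_toL2 {u w : H1 L} (h : u.toL2 = w.toL2) : u = w := by
  have h2 : u.wderiv = w.wderiv := by
    have hu : HasWeakDeriv u.toL2 u.wderiv := u.2
    have hw : HasWeakDeriv w.toL2 w.wderiv := w.2
    rw [h] at hu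
    exact hu.unique hw
  apply Subtype.ext
  apply WithLp.ofLp_injective
  exact Prod.ext h h2

theorem exists_isTest_integral_eq_one (hL : 0 < L) :
    ∃ χ : ℝ → ℝ, IsTest L χ ∧ ∫ x, χ x = 1 := by
  let B : ContDiffBump (L / 2) := ⟨L / 8, L / 4, by positivity, by linarith⟩
  refine ⟨B.normed volume, ⟨B.contDiff_normed, B.hasCompactSupport_normed, ?_⟩,
    B.integral_normed⟩
  rw [B.tsupport_normed_eq, Real.closedBall_eq_Icc]
  intro x hx
  simp only [B, mem_Icc] at hx
  constructor <;> linarith [hx.1, hx.2]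

theorem IsTest.subset_Icc {φ : ℝ → ℝ} (hL : 0 < L) (h : IsTest L φ) :
    ∃ α β, 0 < α ∧ α ≤ β ∧ β < L ∧ ∀ x, x ∉ Icc α β → φ x = 0 := by
  rcases (tsupport φ).eq_empty_or_nonempty with he | hne
  · refine ⟨L / 2, L / 2, by positivity, le_rfl, by linarith, fun x _ => ?_⟩
    exact image_eq_zero_of_notMem_tsupport (by simp [he])
  · obtain ⟨α, hα, hα'⟩ := h.compact.isCompact.exists_isLeast hne
    obtain ⟨β, hβ, hβ'⟩ := h.compact.isCompact.exists_isGreatest hne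
    refine ⟨α, β, (h.supp hα).1, hα' hβ, (h.supp hβ).2, fun x hx => ?_⟩
    exact image_eq_zero_of_notMem_tsupport fun hm => hx ⟨hα' hm, hβ' hm⟩

theorem IsTest.setIntegral_eq {φ : ℝ → ℝ} (h : IsTest L φ) :
    ∫ x in Ioo 0 L, φ x = ∫ x, φ x :=
  setIntegral_eq_integral_of_forall_compl_eq_zero fun _ hx => h.eq_zero_of_notMem hx

theorem IsTest.sub_smul {φ χ : ℝ → ℝ} (h : IsTest L φ) (h' : IsTest L χ) (c : ℝ) :
    IsTest L (fun x => φ x - c * χ x) where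
  smooth := h.smooth.sub (contDiff_const.mul h'.smooth)
  compact := h.compact.sub (h'.compact.mul_left)
  supp := by
    refine (tsupport_sub _ _).trans (union_subset h.supp ?_)
    exact (closure_mono (Function.support_mul_subset_right _ _)).trans h'.supp

/-- A test function with vanishing integral is the derivative of a test function. -/
theorem IsTest.exists_primitive (hL : 0 < L) {φ : ℝ → ℝ} (h : IsTest L φ)
    (h0 : ∫ x, φ x = 0) : ∃ Φ, IsTest L Φ ∧ deriv Φ = φ := by
  have hc := h.smooth.continuous
  obtain ⟨α, β, hα, hαβ, hβ, hz⟩ := h.subset_Icc hL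
  have hd : ∀ x, HasDerivAt (fun y => ∫ t in (0 : ℝ)..y, φ t) (φ x) x := fun x =>
    intervalIntegral.integral_hasDerivAt_right (hc.intervalIntegrable _ _)
      hc.stronglyMeasurable.stronglyMeasurableAtFilter hc.continuousAt
  have hderiv : deriv (fun y => ∫ t in (0 : ℝ)..y, φ t) = φ := funext fun x => (hd x).deriv
  -- To the left of the support the integrand vanishes; to the right the integral is the total one,
  -- which is zero.
  have hvan : ∀ y, y ∉ Icc α β → ∫ t in (0 : ℝ)..y, φ t = 0 := by
    intro y hy
    rcases lt_or_ge y α with hyα | hyα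
    · rw [intervalIntegral.integral_congr (g := fun _ => (0 : ℝ))]
      · simp
      · intro t ht
        apply hz
        intro hm
        have : t ≤ max 0 y := ht.2
        exact absurd (this.trans_lt (max_lt hα hyα)) (not_lt.2 hm.1)
    · have hyβ : β < y := by
        by_contra hcon
        exact hy ⟨hyα, not_lt.1 hcon⟩
      rw [intervalIntegral.integral_of_le (by linarith),
        setIntegral_eq_integral_of_forall_compl_eq_zero, h0]
      intro t ht
      apply hz
      intro hm
      exact ht ⟨hα.trans_le hm.1, hm.2.trans hyβ.le⟩
  have hsub : tsupport (fun y => ∫ t in (0 : ℝ)..y, φ t) ⊆ Icc α β := by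
    refine closure_minimal (fun y hy => ?_) isClosed_Icc
    by_contra hcon
    exact hy (hvan y hcon)
  refine ⟨_, ⟨?_, ?_, ?_⟩, hderiv⟩
  · rw [contDiff_infty_iff_deriv]
    exact ⟨fun x => (hd x).differentiableAt, by rw [hderiv]; exact h.smooth⟩
  · exact isCompact_Icc.of_isClosed_subset (isClosed_tsupport _) hsub
  · exact hsub.trans fun x hx => ⟨hα.trans_le hx.1, hx.2.trans_lt hβ⟩

/-- The lemma of du Bois-Reymond. -/
theorem exists_ae_eq_const (hL : 0 < L) {f : ℝ → ℝ}
    (hf : MemLp f 2 (volume.restrict (Ioo (0 : ℝ) L)))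
    (h : ∀ φ, IsTest L φ → ∫ x in Ioo 0 L, f x * deriv φ x = 0) :
    ∃ c : ℝ, f =ᵐ[volume.restrict (Ioo (0 : ℝ) L)] fun _ => c := by
  obtain ⟨χ, hχ, hχ1⟩ := exists_isTest_integral_eq_one hL
  have hint : ∀ φ, IsTest L φ →
      Integrable (fun x => f x * φ x) (volume.restrict (Ioo (0 : ℝ) L)) := fun φ hφ =>
    MemLp.integrable_mul (p := 2) (q := 2) hf
      ((hφ.smooth.continuous.memLp_of_hasCompactSupport hφ.compact).restrict _)
  have hφi : ∀ φ, IsTest L φ → Integrable φ := fun φ hφ =>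
    hφ.smooth.continuous.integrable_of_hasCompactSupport hφ.compact
  set c := ∫ x in Ioo 0 L, f x * χ x
  refine ⟨c, ?_⟩
  have h1 : (fun x => f x - c) =ᵐ[volume.restrict (Ioo (0 : ℝ) L)] 0 := by
    apply ae_eq_zero_of_integral_test
    · exact (hf.integrable (by norm_num)).sub (integrable_const c)
    · intro φ hφ
      -- Subtracting the multiple of `χ` with the same integral makes the test function a
      -- derivative, to which the hypothesis applies.
      have hT := hφ.sub_smul hχ (∫ x, φ x)
      obtain ⟨Φ, hΦ, hd⟩ := hT.exists_primitive hL (by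
        rw [integral_sub (hφi φ hφ) ((hφi χ hχ).const_mul _), integral_const_mul, hχ1]
        ring)
      have h2 := h Φ hΦ
      rw [hd] at h2
      have e : ∀ x, f x * (φ x - (∫ x, φ x) * χ x)
          = f x * φ x - (∫ x, φ x) * (f x * χ x) := fun x => by ring
      simp only [e] at h2
      rw [integral_sub (hint φ hφ) ((hint χ hχ).const_mul _), integral_const_mul] at h2
      simp only [sub_mul]
      rw [integral_sub (hint φ hφ) ((hφi φ hφ).restrict.const_mul c), integral_const_mul,
        hφ.setIntegral_eq]
      linarith [mul_comm c (∫ x, φ x)]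
  filter_upwards [h1] with x hx
  simpa [sub_eq_zero] using hx

/-- Every element of `H¹(0, L)` extends to a function on `ℝ` that is constant outside `(0, L)`. -/
theorem H1.exists_hasL2Deriv (hL : 0 < L) (u : H1 L) :
    ∃ f : ℝ → ℝ, HasL2Deriv f ((Ioo 0 L).indicator u.wderiv) ∧
      u.toL2 =ᵐ[volume.restrict (Ioo (0 : ℝ) L)] f := by
  set ψ : ℝ → ℝ := (Ioo 0 L).indicator u.wderiv
  have hψm : Measurable ψ := (Lp.stronglyMeasurable u.wderiv).measurable.indicator measurableSet_Ioo
  have hψi : Integrable ψ := (integrable_indicator_iff measurableSet_Ioo).2 (integrable_L2 u.wderiv)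
  have hψ2 : MemLp ψ 2 :=
    (memLp_indicator_iff_restrict measurableSet_Ioo).2 (Lp.memLp u.wderiv)
  have h0 : ∀ c : ℝ, HasL2Deriv (fun x => c + ∫ t in (0 : ℝ)..x, ψ t) ψ := fun c =>
    ⟨hψm, hψi, hψ2, fun x y => by
      rw [← intervalIntegral.integral_interval_sub_left (hψi.intervalIntegrable (a := 0))
        hψi.intervalIntegrable]
      ring⟩
  have hF := h0 0
  have hFm := hF.memLp_restrict L
  -- The difference of `u` and the primitive of its weak derivative has weak derivative zero, hence
  -- is constant.
  obtain ⟨c, hc⟩ := exists_ae_eq_const hL ((Lp.memLp u.toL2).sub hFm) fun φ hφ => by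
    have h1 : HasWeakDeriv u.toL2 u.wderiv := u.2
    have h1 := h1 φ hφ
    have h2 := hF.integral_mul_deriv_test hφ
    have e : ∫ x in Ioo 0 L, ψ x * φ x = ∫ x in Ioo 0 L, u.wderiv x * φ x :=
      setIntegral_congr_fun measurableSet_Ioo fun x hx => by simp only [ψ, indicator_of_mem hx]
    rw [e] at h2
    simp only [Pi.sub_apply, sub_mul]
    rw [integral_sub (integrable_mul_of_compact _ hφ.deriv_continuous hφ.compact.deriv), h1, h2,
      sub_self]
    exact MemLp.integrable_mul (p := 2) (q := 2) hFm
      ((hφ.deriv_continuous.memLp_of_hasCompactSupport hφ.compact.deriv).restrict _)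
  refine ⟨_, h0 c, ?_⟩
  filter_upwards [hc] with x hx
  simp only [Pi.sub_apply, zero_add] at hx
  linarith

namespace H1

theorem exists_rep (hL : 0 < L) (u : H1 L) :
    ∃ f : ℝ → ℝ, HasL2Deriv f ((Ioo 0 L).indicator u.wderiv) ∧
      u.toL2 =ᵐ[volume.restrict (Ioo (0 : ℝ) L)] f ∧ EqOn u.rep f (Icc 0 L) := by
  obtain ⟨f, hf, hae⟩ := u.exists_hasL2Deriv hL
  exact ⟨f, hf, hae, u.rep_eqOn hL hf.continuous.continuousOn hae⟩

theorem rep_continuousOn (hL : 0 < L) (u : H1 L) : ContinuousOn u.rep (Icc 0 L) := by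
  obtain ⟨f, hf, -, he⟩ := u.exists_rep hL
  exact hf.continuous.continuousOn.congr he

theorem toL2_ae_eq_rep (hL : 0 < L) (u : H1 L) :
    u.toL2 =ᵐ[volume.restrict (Ioo (0 : ℝ) L)] u.rep := by
  obtain ⟨f, hf, hae, he⟩ := u.exists_rep hL
  filter_upwards [hae, ae_restrict_mem measurableSet_Ioo] with x hx hm
  rw [hx, he (Ioo_subset_Icc_self hm)]

theorem rep_sub (hL : 0 < L) (u w : H1 L) :
    EqOn (u - w).rep (fun x => u.rep x - w.rep x) (Icc 0 L) := by
  refine rep_eqOn hL _ ((u.rep_continuousOn hL).sub (w.rep_continuousOn hL)) ?_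
  have : (u - w).toL2 = u.toL2 - w.toL2 := rfl
  rw [this]
  filter_upwards [Lp.coeFn_sub u.toL2 w.toL2, u.toL2_ae_eq_rep hL, w.toL2_ae_eq_rep hL]
    with x h1 h2 h3
  rw [h1, Pi.sub_apply, h2, h3]

theorem integral_wderiv (hL : 0 < L) (u : H1 L) :
    ∫ x in Ioo 0 L, u.wderiv x = u.rep L - u.rep 0 := by
  obtain ⟨f, hf, hae, he⟩ := u.exists_rep hL
  rw [he ⟨hL.le, le_rfl⟩, he ⟨le_rfl, hL.le⟩, ← hf.integral_eq, ← setIntegral_Ioo_eq hL.le]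
  exact setIntegral_congr_fun measurableSet_Ioo fun x hx => by simp only [indicator_of_mem hx]

theorem integral_mul_wderiv (hL : 0 < L) (u : H1 L) :
    2 * ∫ x in Ioo 0 L, u.toL2 x * u.wderiv x = u.rep L ^ 2 - u.rep 0 ^ 2 := by
  obtain ⟨f, hf, hae, he⟩ := u.exists_rep hL
  have h := hf.integral_mul_add_mul hf 0 L
  rw [he ⟨hL.le, le_rfl⟩, he ⟨le_rfl, hL.le⟩, sq, sq, ← h, ← setIntegral_Ioo_eq hL.le,
    ← integral_const_mul]
  apply integral_congr_ae
  filter_upwards [hae, ae_restrict_mem measurableSet_Ioo] with x hx hm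
  simp only [indicator_of_mem hm, hx]
  ring

end H1

end TransportNetwork

/-! ### Travelling waves `f (t - κ x)` as curves in `L²` and `H¹`. -/

namespace TransportNetwork

variable {L : ℝ}

theorem continuous_H1_of {X : Type*} [TopologicalSpace X] {u : X → H1 L}
    (h1 : Continuous fun t => (u t).toL2) (h2 : Continuous fun t => (u t).wderiv) :
    Continuous u :=
  Continuous.subtype_mk ((WithLp.prod_continuous_toLp 2 (L2 L) (L2 L)).comp (h1.prodMk h2)) _

theorem eLpNorm_restrict_mul_comp_le {m κ κ' : ℝ → ℝ} (hκ : IsBiLip κ κ') {C : ℝ}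
    (hC : ∀ x, |m x| ≤ C) :
    ∃ K : ENNReal, K ≠ ⊤ ∧ ∀ g : ℝ → ℝ, Measurable g →
      eLpNorm (fun x => m x * g (κ x)) 2 (volume.restrict (Ioo 0 L)) ≤ K * eLpNorm g 2 volume := by
  obtain ⟨K, hK, hle⟩ := hκ.exists_eLpNorm_comp_le
  refine ⟨ENNReal.ofReal C * K, ENNReal.mul_ne_top ENNReal.ofReal_ne_top hK, fun g hg => ?_⟩
  refine (eLpNorm_mono_measure _ Measure.restrict_le_self).trans ?_
  refine (eLpNorm_le_mul_eLpNorm_of_ae_le_mul (g := g ∘ κ) (c := C)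
    (Filter.Eventually.of_forall fun x => ?_) 2).trans ?_
  · rw [norm_mul]
    exact mul_le_mul_of_nonneg_right (hC x) (norm_nonneg _)
  · rw [mul_assoc]
    gcongr
    exact hle g hg

/-- The reflections `y ↦ t - y` preserve Lebesgue measure and depend continuously on `t` in the
compact-open topology, so composition with them is continuous in `L²`. -/
theorem continuous_translate {ψ : ℝ → ℝ} (hψ : MemLp ψ 2) :
    ∃ G : ℝ → Lp ℝ 2 (volume : Measure ℝ), Continuous G ∧
      ∀ t, G t =ᵐ[volume] fun y => ψ (t - y) := by
  have hmp : ∀ t : ℝ, MeasurePreserving (fun y : ℝ => t - y) volume volume := fun t =>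
    volume.measurePreserving_sub_left t
  let g : ℝ → C(ℝ, ℝ) := fun t => ⟨fun y => t - y, by fun_prop⟩
  have hg : Continuous g := ContinuousMap.continuous_of_continuous_uncurry _ (by
    simp only [g, Function.uncurry_def, ContinuousMap.coe_mk]
    fun_prop)
  refine ⟨fun t => Lp.compMeasurePreserving (g t) (hmp t) (hψ.toLp ψ),
    continuous_const.compMeasurePreservingLp hg hmp (by simp), fun t => ?_⟩
  refine (Lp.coeFn_compMeasurePreserving _ (hmp t)).trans ?_
  exact (hmp t).quasiMeasurePreserving.ae_eq_comp hψ.coeFn_toLp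

/-- Continuity of translation in `L²`, along a change of variables and with a bounded weight. -/
theorem continuous_of_ae_eq_mul_comp {ψ m κ κ' : ℝ → ℝ} (hψm : Measurable ψ) (hψ : MemLp ψ 2)
    (hκ : IsBiLip κ κ') {C : ℝ} (hC : ∀ x, |m x| ≤ C) {D : ℝ → L2 L}
    (hD : ∀ t, D t =ᵐ[volume.restrict (Ioo (0 : ℝ) L)] fun x => m x * ψ (t - κ x)) :
    Continuous D := by
  obtain ⟨K, hK, hle⟩ := eLpNorm_restrict_mul_comp_le (L := L) hκ hC
  obtain ⟨G, hG, hGe⟩ := continuous_translate hψ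
  -- The constant `K` depends only on `m` and `κ`, so the continuity of `G` passes to `D`.
  have key : ∀ s t, edist (D s) (D t) ≤ K * edist (G s) (G t) := by
    intro s t
    rw [Lp.edist_def, Lp.edist_def]
    have hm : Measurable fun y => ψ (s - y) - ψ (t - y) :=
      (hψm.comp (measurable_const.sub measurable_id)).sub
        (hψm.comp (measurable_const.sub measurable_id))
    have h1 : (⇑(D s) - ⇑(D t)) =ᵐ[volume.restrict (Ioo (0 : ℝ) L)]
        fun x => m x * (ψ (s - κ x) - ψ (t - κ x)) := by
      filter_upwards [hD s, hD t] with x h1 h2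
      simp only [Pi.sub_apply, h1, h2]
      ring
    have h2 : (⇑(G s) - ⇑(G t)) =ᵐ[volume] fun y => ψ (s - y) - ψ (t - y) := by
      filter_upwards [hGe s, hGe t] with x h1 h2
      simp only [Pi.sub_apply, h1, h2]
    rw [eLpNorm_congr_ae h1, eLpNorm_congr_ae h2]
    exact hle (fun y => ψ (s - y) - ψ (t - y)) hm
  refine continuous_iff_continuousAt.2 fun t => tendsto_iff_edist_tendsto_0.2 ?_
  have h0 : Filter.Tendsto (fun s => K * edist (G s) (G t)) (nhds t) (nhds 0) := by
    have := ENNReal.Tendsto.const_mul (a := K)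
      (tendsto_iff_edist_tendsto_0.1 (hG.tendsto t)) (Or.inr hK)
    simpa using this
  exact tendsto_of_tendsto_of_tendsto_of_le_of_le tendsto_const_nhds h0
    (fun _ => zero_le) fun s => key s t

/-- Fubini: translation invariance gives every slice in `r` the same `L¹` norm, and `μ` is finite.
-/
theorem HasL2Deriv.intervalIntegral_integral_comp {f ψ κ : ℝ → ℝ} (h : HasL2Deriv f ψ)
    (hκ : Measurable κ) (μ : Measure ℝ) [IsFiniteMeasure μ] (s t : ℝ) :
    ∫ r in s..t, ∫ x, ψ (r - κ x) ∂μ = ∫ x, (f (t - κ x) - f (s - κ x)) ∂μ := by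
  have hm : Measurable fun p : ℝ × ℝ => ψ (p.2 - κ p.1) :=
    h.meas.comp (measurable_snd.sub (hκ.comp measurable_fst))
  have hi : Integrable (fun p : ℝ × ℝ => ψ (p.2 - κ p.1)) (μ.prod volume) := by
    refine (integrable_prod_iff hm.aestronglyMeasurable).2 ⟨?_, ?_⟩
    · exact Filter.Eventually.of_forall fun x => h.integrable.comp_sub_right (κ x)
    · have : ∀ x, ∫ r, ‖ψ (r - κ x)‖ = ∫ r, ‖ψ r‖ := fun x =>
        integral_sub_right_eq_self (fun r => ‖ψ r‖) (κ x)
      simp only [this]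
      exact integrable_const _
  rw [intervalIntegral_integral_swap]
  · congr 1
    funext x
    rw [intervalIntegral.integral_comp_sub_right, h.integral_eq]
  · have := hi.swap.mono_measure
      (Measure.prod_mono (Measure.restrict_le_self (s := uIoc s t)) (le_refl μ))
    exact this

theorem L2_ext_of_setIntegral {F G : L2 L}
    (h : ∀ S, MeasurableSet S → ∫ x in S, F x ∂(volume.restrict (Ioo (0 : ℝ) L))
      = ∫ x in S, G x ∂(volume.restrict (Ioo (0 : ℝ) L))) : F = G :=
  Lp.ext (ae_eq_of_forall_setIntegral_eq_of_sigmaFinite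
    (fun _ _ _ => (integrable_L2 F).integrableOn) (fun _ _ _ => (integrable_L2 G).integrableOn)
    fun S hS _ => h S hS)

/-- Integration over `S` is the inner product with an indicator, a continuous functional, so it
commutes with the Bochner integral. -/
theorem setIntegral_intervalIntegral {D : ℝ → L2 L} (hD : Continuous D) {S : Set ℝ}
    (hS : MeasurableSet S) (s t : ℝ) :
    ∫ x in S, (∫ r in s..t, D r : L2 L) x ∂(volume.restrict (Ioo (0 : ℝ) L))
      = ∫ r in s..t, ∫ x in S, D r x ∂(volume.restrict (Ioo (0 : ℝ) L)) := by
  have hne : (volume.restrict (Ioo (0 : ℝ) L)) S ≠ ⊤ := measure_ne_top _ _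
  simp only [← L2.inner_indicatorConstLp_one (𝕜 := ℝ) hS hne]
  exact (ContinuousLinearMap.intervalIntegral_comp_comm (innerSL ℝ (indicatorConstLp 2 hS hne 1))
    (hD.intervalIntegrable s t)).symm

section EdgeFlow

variable {f ψ κ κ' : ℝ → ℝ} (hf : HasL2Deriv f ψ) (hκ : IsBiLip κ κ')

/-- The wave `x ↦ f (t - κ x)` as an element of `H¹(0, L)`. -/
noncomputable def edgeFlow (L t : ℝ) : H1 L := (hf.comp (hκ.sub_left t)).toH1 L

/-- The time derivative of the wave `x ↦ f (t - κ x)`. -/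
noncomputable def edgeFlowDeriv (L t : ℝ) : L2 L :=
  ((hκ.sub_left t).memLp_comp hf.meas hf.memLp |>.restrict (Ioo 0 L)).toLp _

theorem toL2_edgeFlow_ae (L t : ℝ) :
    (edgeFlow hf hκ L t).toL2 =ᵐ[volume.restrict (Ioo (0 : ℝ) L)] fun x => f (t - κ x) :=
  (hf.comp (hκ.sub_left t)).toL2_toH1_ae L

theorem wderiv_edgeFlow_ae (L t : ℝ) :
    (edgeFlow hf hκ L t).wderiv =ᵐ[volume.restrict (Ioo (0 : ℝ) L)]
      fun x => -κ' x * ψ (t - κ x) :=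
  (hf.comp (hκ.sub_left t)).wderiv_toH1_ae L

theorem edgeFlowDeriv_ae (L t : ℝ) :
    edgeFlowDeriv hf hκ L t =ᵐ[volume.restrict (Ioo (0 : ℝ) L)] fun x => ψ (t - κ x) :=
  MemLp.coeFn_toLp ((hκ.sub_left t).memLp_comp hf.meas hf.memLp |>.restrict (Ioo 0 L))

theorem rep_edgeFlow (hL : 0 < L) (t : ℝ) :
    EqOn (edgeFlow hf hκ L t).rep (fun x => f (t - κ x)) (Icc 0 L) :=
  H1.rep_eqOn hL _ (hf.comp (hκ.sub_left t)).continuous.continuousOn (toL2_edgeFlow_ae hf hκ L t)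

theorem continuous_edgeFlowDeriv : Continuous (edgeFlowDeriv hf hκ L) :=
  continuous_of_ae_eq_mul_comp (m := fun _ => 1) (C := 1) hf.meas hf.memLp hκ (by simp)
    fun t => by simpa using edgeFlowDeriv_ae hf hκ L t

/-- The integral on the right is a Bochner integral in `L²`, without pointwise meaning a priori.
Testing with indicators reduces the identity to Fubini and `f y - f x = ∫ ψ`. With the continuity of
`edgeFlowDeriv` it gives the time derivative. -/
theorem toL2_edgeFlow_eq (L t : ℝ) :
    (edgeFlow hf hκ L t).toL2
      = (edgeFlow hf hκ L 0).toL2 + ∫ r in (0 : ℝ)..t, edgeFlowDeriv hf hκ L r := by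
  refine L2_ext_of_setIntegral fun S hS => ?_
  let μ := volume.restrict (Ioo (0 : ℝ) L)
  have hadd : ∫ x in S, ((edgeFlow hf hκ L 0).toL2
        + ∫ r in (0 : ℝ)..t, edgeFlowDeriv hf hκ L r : L2 L) x ∂μ
      = ∫ x in S, (edgeFlow hf hκ L 0).toL2 x ∂μ
        + ∫ x in S, (∫ r in (0 : ℝ)..t, edgeFlowDeriv hf hκ L r : L2 L) x ∂μ := by
    rw [← integral_add (integrable_L2 _).integrableOn (integrable_L2 _).integrableOn]
    exact integral_congr_ae (ae_restrict_of_ae (Lp.coeFn_add _ _))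
  have hr : ∀ r, ∫ x in S, edgeFlowDeriv hf hκ L r x ∂μ = ∫ x in S, ψ (r - κ x) ∂μ := fun r =>
    integral_congr_ae (ae_restrict_of_ae (edgeFlowDeriv_ae hf hκ L r))
  have hI : ∀ r, Integrable (fun x => f (r - κ x)) (μ.restrict S) := fun r =>
    ((integrable_L2 _).congr (toL2_edgeFlow_ae hf hκ L r)).integrableOn
  rw [hadd, setIntegral_intervalIntegral (continuous_edgeFlowDeriv hf hκ) hS]
  rw [intervalIntegral.integral_congr fun r _ => hr r,
    hf.intervalIntegral_integral_comp hκ.continuous.measurable, integral_sub (hI t) (hI 0),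
    integral_congr_ae (ae_restrict_of_ae (toL2_edgeFlow_ae hf hκ L t)),
    integral_congr_ae (ae_restrict_of_ae (toL2_edgeFlow_ae hf hκ L 0))]
  ring

theorem hasDerivAt_edgeFlow (L t : ℝ) :
    HasDerivAt (fun s => (edgeFlow hf hκ L s).toL2) (edgeFlowDeriv hf hκ L t) t := by
  have hc := continuous_edgeFlowDeriv hf hκ (L := L)
  rw [show (fun s => (edgeFlow hf hκ L s).toL2) = fun s => (edgeFlow hf hκ L 0).toL2
    + ∫ r in (0 : ℝ)..s, edgeFlowDeriv hf hκ L r from funext fun s => toL2_edgeFlow_eq hf hκ L s]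
  exact (hc.integral_hasStrictDerivAt 0 t).hasDerivAt.const_add _

theorem continuous_edgeFlow : Continuous (edgeFlow hf hκ L) := by
  obtain ⟨C, hC⟩ := hκ.upper
  refine continuous_H1_of (continuous_iff_continuousAt.2 fun t =>
    (hasDerivAt_edgeFlow hf hκ L t).continuousAt) ?_
  exact continuous_of_ae_eq_mul_comp hf.meas hf.memLp hκ (by simpa using hC)
    fun t => wderiv_edgeFlow_ae hf hκ L t

end EdgeFlow

end TransportNetwork

/-! ### Travel times along an edge. -/

namespace TransportNetwork

variable {L : ℝ}

theorem H1.exists_continuous_bounds (hL : 0 < L) {a : H1 L} {a₀ : ℝ}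
    (ha : ∀ᵐ x ∂(volume.restrict (Ioo 0 L)), a₀ ≤ a.toL2 x) :
    ∃ A : ℝ → ℝ, Continuous A ∧ (∀ x, a₀ ≤ A x) ∧ (∃ C, ∀ x, A x ≤ C) ∧
      a.toL2 =ᵐ[volume.restrict (Ioo (0 : ℝ) L)] A := by
  obtain ⟨f, hf, hae, -⟩ := a.exists_rep hL
  have hle : ∀ x ∈ Icc 0 L, a₀ ≤ f x := by
    -- The bound is known only almost everywhere; both sides are continuous, so it extends to all of
    -- `[0, L]`.
    have hmax : EqOn (fun x => max a₀ (f x)) f (Icc 0 L) := by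
      refine eqOn_of_ae_eq hL (by have := hf.continuous; fun_prop) hf.continuous.continuousOn ?_
      filter_upwards [ha, hae] with x h1 h2
      exact max_eq_right (h2 ▸ h1)
    exact fun x hx => max_eq_right_iff.1 (hmax hx)
  have hmem : ∀ x, max 0 (min L x) ∈ Icc 0 L := fun x =>
    ⟨le_max_left _ _, max_le hL.le (min_le_left _ _)⟩
  obtain ⟨C, hC⟩ := isCompact_Icc.exists_bound_of_continuousOn
    (hf.continuous.continuousOn (s := Icc 0 L))
  -- Clamping the argument to `[0, L]` makes the bounds global.
  refine ⟨fun x => f (max 0 (min L x)), by have := hf.continuous; fun_prop,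
    fun x => hle _ (hmem x), ⟨C, fun x => (le_abs_self _).trans (hC _ (hmem x))⟩, ?_⟩
  filter_upwards [hae, ae_restrict_mem measurableSet_Ioo] with x hx hm
  rw [hx, min_eq_right hm.2.le, max_eq_right hm.1.le]

/-- The inverse of a primitive of a function that is bounded below by a positive constant. -/
theorem exists_inverse_of_deriv_ge {Θ A : ℝ → ℝ} (hA : Continuous A)
    (hΘ : ∀ x, HasDerivAt Θ (A x) x) {a₀ : ℝ} (ha₀ : 0 < a₀) (hle : ∀ x, a₀ ≤ A x) :
    StrictMono Θ ∧ ∃ σ : ℝ → ℝ, Continuous σ ∧ (∀ x, σ (Θ x) = x) ∧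
      ∀ y, HasDerivAt σ (A (σ y))⁻¹ y := by
  have hmono : StrictMono Θ := strictMono_of_deriv_pos fun x => by
    rw [(hΘ x).deriv]; exact ha₀.trans_le (hle x)
  have hcont : Continuous Θ := continuous_iff_continuousAt.2 fun x => (hΘ x).continuousAt
  -- At least linear growth makes `Θ` surjective.
  have hgrow : ∀ x y, x ≤ y → a₀ * (y - x) ≤ Θ y - Θ x := by
    intro x y hxy
    rw [← intervalIntegral.integral_eq_sub_of_hasDerivAt (fun t _ => hΘ t)
      (hA.intervalIntegrable x y)]
    calc a₀ * (y - x) = ∫ _ in x..y, a₀ := by simp [mul_comm]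
      _ ≤ _ := intervalIntegral.integral_mono_on hxy (by simp) (hA.intervalIntegrable x y)
        fun t _ => hle t
  have hsurj : Function.Surjective Θ := by
    intro y
    refine mem_range_of_exists_le_of_exists_ge hcont ⟨-(|y - Θ 0| / a₀), ?_⟩ ⟨|y - Θ 0| / a₀, ?_⟩
    · have h1 := hgrow (-(|y - Θ 0| / a₀)) 0 (by simp only [Left.neg_nonpos_iff]; positivity)
      rw [zero_sub, neg_neg, mul_div_cancel₀ _ ha₀.ne'] at h1
      linarith [neg_abs_le (y - Θ 0)]
    · have h1 := hgrow 0 (|y - Θ 0| / a₀) (by positivity)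
      rw [sub_zero, mul_div_cancel₀ _ ha₀.ne'] at h1
      linarith [le_abs_self (y - Θ 0)]
  let e : ℝ ≃o ℝ := hmono.orderIsoOfSurjective Θ hsurj
  refine ⟨hmono, e.symm, e.symm.continuous, fun x => e.symm_apply_apply x, fun y => ?_⟩
  exact HasDerivAt.of_local_left_inverse e.symm.continuous.continuousAt (hΘ _)
    (ha₀.trans_le (hle _)).ne' (Filter.Eventually.of_forall fun z => e.apply_symm_apply z)

/-- Travel times `κ` along an edge, measured from the point `x₀`, and the function `q` of
(negative) entrance times corresponding to the initial values. -/
theorem exists_travel_time (hL : 0 < L) {a : H1 L} {a₀ : ℝ} (ha₀ : 0 < a₀)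
    (ha : ∀ᵐ x ∂(volume.restrict (Ioo 0 L)), a₀ ≤ a.toL2 x) {b : ℝ} (hb : b ≠ 0) (x₀ : ℝ)
    (u₀ : H1 L) :
    ∃ κ κ' q ψ : ℝ → ℝ, IsBiLip κ κ' ∧ κ x₀ = 0 ∧ StrictMono (fun x => b * κ x) ∧
      (a.toL2 =ᵐ[volume.restrict (Ioo (0 : ℝ) L)] fun x => b * κ' x) ∧
      HasL2Deriv q ψ ∧ ∀ x ∈ Icc 0 L, q (-κ x) = u₀.rep x := by
  obtain ⟨A, hA, hle, ⟨C, hC⟩, hae⟩ := H1.exists_continuous_bounds hL ha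
  obtain ⟨f, hf, -, hrep⟩ := u₀.exists_rep hL
  have hpos : ∀ x, 0 < A x := fun x => ha₀.trans_le (hle x)
  have hCpos : 0 < C := (hpos 0).trans_le (hC 0)
  have hΘ : ∀ x, HasDerivAt (fun y => ∫ t in x₀..y, A t) (A x) x := fun x =>
    (hA.integral_hasStrictDerivAt x₀ x).hasDerivAt
  obtain ⟨hmono, σ, hσc, hσ, hσd⟩ := exists_inverse_of_deriv_ge hA hΘ ha₀ hle
  have hκ : IsBiLip (fun x => b⁻¹ * ∫ t in x₀..x, A t) (fun x => b⁻¹ * A x) := by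
    refine ⟨fun x => (hΘ x).const_mul _, by fun_prop, ?_, ⟨|b⁻¹| * a₀, by positivity, fun x => ?_⟩,
      ⟨|b⁻¹| * C, fun x => ?_⟩⟩
    · rcases lt_or_gt_of_ne hb with h | h
      · exact Or.inr fun x => mul_neg_of_neg_of_pos (inv_lt_zero.2 h) (hpos x)
      · exact Or.inl fun x => mul_pos (inv_pos.2 h) (hpos x)
    · rw [abs_mul, abs_of_pos (hpos x)]
      exact mul_le_mul_of_nonneg_left (hle x) (abs_nonneg _)
    · rw [abs_mul, abs_of_pos (hpos x)]
      exact mul_le_mul_of_nonneg_left (hC x) (abs_nonneg _)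
  -- Since `σ` inverts `Θ = b κ`, the map `s ↦ σ (-b s)` inverts `x ↦ -κ x`. Composing the extension
  -- of `u₀` with it gives `q`.
  have hη : IsBiLip (fun s => σ (-b * s)) (fun s => (A (σ (-b * s)))⁻¹ * (-b)) := by
    refine ⟨fun s => ?_, ?_, ?_, ⟨C⁻¹ * |b|, by positivity, fun x => ?_⟩,
      ⟨a₀⁻¹ * |b|, fun x => ?_⟩⟩
    · have h1 : HasDerivAt (fun s : ℝ => -b * s) (-b) s := by
        simpa using (hasDerivAt_id s).const_mul (-b)
      exact (hσd (-b * s)).comp s h1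
    · refine Continuous.mul (Continuous.inv₀ (by fun_prop) fun s => (hpos _).ne') continuous_const
    · rcases lt_or_gt_of_ne hb with h | h
      · exact Or.inl fun x => mul_pos (inv_pos.2 (hpos _)) (neg_pos.2 h)
      · exact Or.inr fun x => mul_neg_of_pos_of_neg (inv_pos.2 (hpos _)) (neg_lt_zero.2 h)
    · rw [abs_mul, abs_inv, abs_neg, abs_of_pos (hpos _)]
      exact mul_le_mul_of_nonneg_right (inv_anti₀ (hpos _) (hC _)) (abs_nonneg _)
    · rw [abs_mul, abs_inv, abs_neg, abs_of_pos (hpos _)]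
      exact mul_le_mul_of_nonneg_right (inv_anti₀ ha₀ (hle _)) (abs_nonneg _)
  refine ⟨_, _, _, _, hκ, by simp, ?_, ?_, hf.comp hη, fun x hx => ?_⟩
  · simpa only [mul_inv_cancel_left₀ hb] using hmono
  · simpa only [mul_inv_cancel_left₀ hb] using hae
  · rw [neg_mul_neg, mul_inv_cancel_left₀ hb, hσ, hrep hx]

end TransportNetwork

/-! ### Mass and energy balance on an edge, and summation by parts over the vertices. -/

namespace TransportNetwork

variable {L : ℝ}

theorem inner_L2_eq (f g : L2 L) : inner ℝ f g = ∫ x in Ioo 0 L, f x * g x := by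
  rw [L2.inner_def]
  congr 1
  funext x
  simp [mul_comm]

/-- Multiplication by (the bounded function) `a ∈ H¹(0, L)` is a bounded operator on `L²(0, L)`. -/
theorem H1.exists_mulL (hL : 0 < L) (a : H1 L) :
    ∃ M : L2 L →L[ℝ] L2 L, ∀ u, M u =ᵐ[volume.restrict (Ioo (0 : ℝ) L)]
      fun x => a.toL2 x * u x := by
  -- The continuous representative is bounded, hence an `L^∞` multiplier.
  have hm := memLp_of_continuousOn (a.rep_continuousOn hL) ⊤
  refine ⟨(ContinuousLinearMap.mul ℝ ℝ).holderL _ ⊤ 2 2 (hm.toLp _), fun u => ?_⟩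
  filter_upwards [(ContinuousLinearMap.mul ℝ ℝ).coeFn_holder (r := 2) (hm.toLp _) u,
    hm.coeFn_toLp, a.toL2_ae_eq_rep hL] with x h1 h2 h3
  rw [h3, ← h2]
  exact h1

theorem H1.wderiv_smul_ae (b : ℝ) (u : H1 L) :
    (b • u).wderiv =ᵐ[volume.restrict (Ioo (0 : ℝ) L)] fun x => b * u.wderiv x :=
  Lp.coeFn_smul b u.wderiv

section EdgeBalance

variable (hL : 0 < L) {a : H1 L} {b : ℝ} {v : ℝ → H1 L} {d : L2 L} {S : Set ℝ} {t : ℝ}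
  (hv : HasDerivWithinAt (fun s => (v s).toL2) d S t)
  (htr : ∀ᵐ x ∂(volume.restrict (Ioo (0 : ℝ) L)),
    a.toL2 x * d x + (b • v t : H1 L).wderiv x = 0)

include hL hv htr

/-- The mass is the fixed functional `⟨a, ·⟩`; by the equation its derivative is `-b` times the
integral of `∂ₓ v`. -/
theorem hasDerivWithinAt_edge_mass :
    HasDerivWithinAt (fun s => ∫ x in Ioo 0 L, a.toL2 x * (v s).toL2 x)
      (-(b * ((v t).rep L - (v t).rep 0))) S t := by
  have h1 := (innerSL ℝ a.toL2).hasFDerivAt.comp_hasDerivWithinAt t hv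
  have h2 : inner ℝ a.toL2 d = -(b * ((v t).rep L - (v t).rep 0)) := by
    rw [inner_L2_eq, ← H1.integral_wderiv hL, ← integral_const_mul, ← integral_neg]
    apply integral_congr_ae
    filter_upwards [htr, H1.wderiv_smul_ae b (v t)] with x h1 h2
    rw [h2] at h1
    linarith
  rw [← h2]
  simp only [← inner_L2_eq]
  exact h1

/-- The energy is the quadratic form `⟨v, M v⟩` of multiplication by `a`. The equation turns its
derivative into `-2b ∫ v ∂ₓ v`, a difference of end point squares. -/
theorem hasDerivWithinAt_edge_energy (ha : ∀ᵐ x ∂(volume.restrict (Ioo 0 L)), 0 ≤ a.toL2 x) :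
    HasDerivWithinAt (fun s => ∫ x in Ioo 0 L, (Real.sqrt (a.toL2 x) * (v s).toL2 x) ^ 2)
      (-(b * ((v t).rep L ^ 2 - (v t).rep 0 ^ 2))) S t := by
  obtain ⟨M, hM⟩ := a.exists_mulL hL
  have h1 := hv.inner ℝ (M.hasFDerivAt.comp_hasDerivWithinAt t hv)
  have h2 : inner ℝ (v t).toL2 (M d) + inner ℝ d (M (v t).toL2)
      = -(b * ((v t).rep L ^ 2 - (v t).rep 0 ^ 2)) := by
    rw [← H1.integral_mul_wderiv hL, ← integral_const_mul, ← integral_const_mul, ← integral_neg,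
      inner_L2_eq, inner_L2_eq, ← integral_add (integrable_mul_L2 _ _) (integrable_mul_L2 _ _)]
    apply integral_congr_ae
    filter_upwards [htr, H1.wderiv_smul_ae b (v t), hM d, hM (v t).toL2] with x h1 h2 h3 h4
    rw [h2] at h1
    rw [h3, h4]
    linear_combination 2 * (v t).toL2 x * h1
  rw [← h2]
  refine h1.congr_of_eventuallyEq (Filter.Eventually.of_forall fun s => ?_) ?_ <;>
  · simp only [Function.comp_apply]
    rw [inner_L2_eq]
    apply integral_congr_ae
    filter_upwards [ha, hM (v _).toL2] with x h1 h2
    rw [h2, mul_pow, Real.sq_sqrt h1]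
    ring

end EdgeBalance

namespace Network

variable {V E : Type*} [DecidableEq V] (N : Network V E)

theorem val_tgt (u : N.H1pw) (e : E) : N.val u e (N.tgt e) = (u e).rep (N.len e) := by
  simp [val]

theorem val_src (u : N.H1pw) (e : E) : N.val u e (N.src e) = (u e).rep 0 := by
  simp [val, N.src_ne_tgt e]

theorem normal_tgt (e : E) : N.normal e (N.tgt e) = 1 := by
  simp [normal, (N.src_ne_tgt e).symm]

theorem normal_src (e : E) : N.normal e (N.src e) = -1 := by
  simp [normal]

variable [Fintype E]

theorem normal_eq_zero {e : E} {v : V} (h : e ∉ N.edgesAt v) : N.normal e v = 0 := by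
  simp only [edgesAt, Finset.mem_filter, Finset.mem_univ, true_and, not_or] at h
  simp [normal, Ne.symm h.1, Ne.symm h.2]

theorem normal_ne_zero {e : E} {v : V} (h : e ∈ N.edgesAt v) : N.normal e v ≠ 0 := by
  simp only [edgesAt, Finset.mem_filter, Finset.mem_univ, true_and] at h
  rcases h with h | h
  · rw [← h, normal_src]; norm_num
  · rw [← h, normal_tgt]; norm_num

variable {N} (b : E → ℝ)

theorem mem_edgesIn {e : E} {v : V} : e ∈ N.edgesIn b v ↔ 0 < b e * N.normal e v := by
  simp [edgesIn]

theorem mem_edgesOut {e : E} {v : V} : e ∈ N.edgesOut b v ↔ b e * N.normal e v < 0 := by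
  simp [edgesOut]

theorem mem_edgesAt {e : E} {v : V} : e ∈ N.edgesAt v ↔ N.src e = v ∨ N.tgt e = v := by
  simp [edgesAt]

theorem sum_edgesAt_mul (v : V) (G : E → ℝ) :
    ∑ e ∈ N.edgesAt v, b e * N.normal e v * G e = ∑ e, b e * N.normal e v * G e :=
  Finset.sum_subset (Finset.subset_univ _) fun e _ he => by rw [N.normal_eq_zero he]; ring

theorem sum_edgesAt_eq_in_add_out (v : V) (G : E → ℝ) :
    ∑ e ∈ N.edgesAt v, b e * N.normal e v * G e
      = ∑ e ∈ N.edgesIn b v, b e * N.normal e v * G e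
        + ∑ e ∈ N.edgesOut b v, b e * N.normal e v * G e := by
  rw [sum_edgesAt_mul, edgesIn, edgesOut, Finset.sum_filter, Finset.sum_filter,
    ← Finset.sum_add_distrib]
  refine Finset.sum_congr rfl fun e _ => ?_
  rcases lt_trichotomy (b e * N.normal e v) 0 with h | h | h
  · simp [h, h.not_gt]
  · simp [h]
  · simp [h, h.not_gt]

variable [Fintype V]

/-- A discrete divergence theorem: `n^e` is `1` at the end, `-1` at the start and `0` elsewhere. -/
theorem sum_edges_eq_sum_vertices (F : E → V → ℝ) :
    ∑ e, b e * (F e (N.tgt e) - F e (N.src e))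
      = ∑ v, ∑ e ∈ N.edgesAt v, b e * N.normal e v * F e v := by
  simp only [sum_edgesAt_mul]
  rw [Finset.sum_comm]
  refine Finset.sum_congr rfl fun e _ => ?_
  rw [Finset.sum_eq_add (N.tgt e) (N.src e) (N.src_ne_tgt e).symm, normal_tgt, normal_src]
  · ring
  · intro v _ hv
    rw [normal_eq_zero, mul_zero, zero_mul]
    rw [mem_edgesAt]
    exact fun h => h.elim (fun h => hv.2 h.symm) fun h => hv.1 h.symm
  · simp
  · simp

section Vertices

variable {b} (hb : ∀ v, ∃ e ∈ N.edgesAt v, b e ≠ 0)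

include hb

theorem exists_edgesAt_eq_singleton {v : V} (hv : v ∈ N.boundary) :
    ∃ e, N.edgesAt v = {e} ∧ b e * N.normal e v ≠ 0 := by
  obtain ⟨e, he, hbe⟩ := hb v
  simp only [boundary, inner, Finset.mem_sdiff, Finset.mem_univ, true_and, Finset.mem_filter,
    not_le] at hv
  refine ⟨e, (Finset.eq_of_subset_of_card_le (Finset.singleton_subset_iff.2 he) ?_).symm,
    mul_ne_zero hbe (N.normal_ne_zero he)⟩
  rw [Finset.card_singleton]
  omega

theorem boundary_eq : N.inflow b ∪ N.outflow b = N.boundary := by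
  ext v
  simp only [inflow, outflow, Finset.mem_union, Finset.mem_filter, ← and_or_left,
    and_iff_left_iff_imp]
  intro hv
  obtain ⟨e, he, hne⟩ := exists_edgesAt_eq_singleton hb hv
  simpa [he] using lt_or_gt_of_ne hne

theorem disjoint_inflow_outflow : Disjoint (N.inflow b) (N.outflow b) := by
  rw [Finset.disjoint_left]
  intro v hv hv'
  simp only [inflow, outflow, Finset.mem_filter] at hv hv'
  obtain ⟨e, he, -⟩ := hb v
  exact lt_asymm (hv.2 e he) (hv'.2 e he)

theorem sum_vertices (F : V → ℝ) :
    ∑ v, F v = ∑ v ∈ N.inner, F v + (∑ v ∈ N.inflow b, F v + ∑ v ∈ N.outflow b, F v) := by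
  rw [← Finset.sum_union (disjoint_inflow_outflow hb), boundary_eq hb, boundary,
    add_comm, Finset.sum_sdiff (Finset.subset_univ _)]

theorem inflow_or (v : V) : v ∈ N.inflow b ∨ v ∈ N.inner ∪ N.outflow b := by
  by_cases h : v ∈ N.inner
  · exact Or.inr (Finset.mem_union_left _ h)
  · have h' : v ∈ N.boundary := by simp [boundary, h]
    rw [← boundary_eq hb, Finset.mem_union] at h'
    exact h'.imp_right (Finset.mem_union_right _)

variable (hflow : ∀ v ∈ N.inner, ∑ e ∈ N.edgesAt v, b e * N.normal e v = 0)

include hflow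

/-- At a junction without incoming flow all terms of the vanishing flow sum would be nonpositive,
hence zero, against `hb`. Positivity lets the mixing condition determine the vertex value. -/
theorem sum_edgesIn_pos {v : V} (hv : v ∈ N.inner ∪ N.outflow b) :
    0 < ∑ e ∈ N.edgesIn b v, b e * N.normal e v := by
  refine Finset.sum_pos (fun e he => (mem_edgesIn b).1 he) ?_
  obtain ⟨e, he, hbe⟩ := hb v
  rcases Finset.mem_union.1 hv with h | h
  · by_contra hne
    have h1 : ∀ e ∈ N.edgesAt v, b e * N.normal e v ≤ 0 := by
      intro e _
      by_contra hcon
      exact hne ⟨e, (mem_edgesIn b).2 (not_le.1 hcon)⟩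
    have h2 := (Finset.sum_eq_zero_iff_of_nonpos h1).1 (hflow v h) e he
    exact mul_ne_zero hbe (N.normal_ne_zero he) h2
  · simp only [outflow, Finset.mem_filter] at h
    exact ⟨e, (mem_edgesIn b).2 (h.2 e he)⟩

omit hb in
theorem sum_edgesOut_eq {v : V} (hv : v ∈ N.inner) :
    ∑ e ∈ N.edgesOut b v, b e * N.normal e v = - ∑ e ∈ N.edgesIn b v, b e * N.normal e v := by
  have h := sum_edgesAt_eq_in_add_out (N := N) b v fun _ => 1
  simp only [mul_one] at h
  rw [hflow v hv] at h
  linarith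

/-- The flux balance at the vertices. -/
theorem sum_flux_eq {F : E → V → ℝ} {c : V → ℝ}
    (hout : ∀ v, ∀ e ∈ N.edgesOut b v, F e v = c v)
    (hmix : ∀ v ∈ N.inner ∪ N.outflow b,
      ∑ e ∈ N.edgesIn b v, b e * N.normal e v * c v
        = ∑ e ∈ N.edgesIn b v, b e * N.normal e v * F e v) :
    ∑ e, b e * (F e (N.tgt e) - F e (N.src e))
      = ∑ v ∈ N.boundary, ∑ e ∈ N.edgesAt v, b e * N.normal e v * F e v := by
  rw [sum_edges_eq_sum_vertices, sum_vertices hb,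
    ← Finset.sum_union (disjoint_inflow_outflow hb), boundary_eq hb]
  -- At a junction the outgoing flux is minus the total inflow times the vertex value, and by mixing
  -- it cancels the incoming flux.
  refine (add_eq_right).2 (Finset.sum_eq_zero fun v hv => ?_)
  rw [sum_edgesAt_eq_in_add_out, ← hmix v (Finset.mem_union_left _ hv),
    Finset.sum_congr (s₁ := N.edgesOut b v) rfl fun e he => by rw [hout v e he],
    ← Finset.sum_mul, ← Finset.sum_mul, sum_edgesOut_eq hflow hv]
  ring

/-- The balance of the squares at the vertices. -/
theorem sum_flux_sq_eq {F : E → V → ℝ} {c : V → ℝ}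
    (hout : ∀ v, ∀ e ∈ N.edgesOut b v, F e v = c v)
    (hmix : ∀ v ∈ N.inner ∪ N.outflow b,
      ∑ e ∈ N.edgesIn b v, b e * N.normal e v * c v
        = ∑ e ∈ N.edgesIn b v, b e * N.normal e v * F e v) :
    -∑ e, b e * (F e (N.tgt e) ^ 2 - F e (N.src e) ^ 2)
      = -(∑ v ∈ N.outflow b, ∑ e ∈ N.edgesAt v, |b e * N.normal e v| * |F e v| ^ 2)
        + (∑ v ∈ N.inflow b, ∑ e ∈ N.edgesAt v, |b e * N.normal e v| * |c v| ^ 2)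
        - ∑ v ∈ N.inner, ∑ e ∈ N.edgesIn b v, |b e * N.normal e v| * |F e v - c v| ^ 2 := by
  have h1 : ∑ v ∈ N.inflow b, ∑ e ∈ N.edgesAt v, b e * N.normal e v * F e v ^ 2
      = -∑ v ∈ N.inflow b, ∑ e ∈ N.edgesAt v, |b e * N.normal e v| * |c v| ^ 2 := by
    rw [← Finset.sum_neg_distrib]
    refine Finset.sum_congr rfl fun v hv => ?_
    rw [← Finset.sum_neg_distrib]
    refine Finset.sum_congr rfl fun e he => ?_
    simp only [inflow, Finset.mem_filter] at hv
    have hlt := hv.2 e he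
    rw [hout v e ((mem_edgesOut b).2 hlt), sq_abs, abs_of_neg hlt]
    ring
  have h2 : ∑ v ∈ N.outflow b, ∑ e ∈ N.edgesAt v, b e * N.normal e v * F e v ^ 2
      = ∑ v ∈ N.outflow b, ∑ e ∈ N.edgesAt v, |b e * N.normal e v| * |F e v| ^ 2 := by
    refine Finset.sum_congr rfl fun v hv => Finset.sum_congr rfl fun e he => ?_
    simp only [outflow, Finset.mem_filter] at hv
    rw [sq_abs, abs_of_pos (hv.2 e he)]
  have h3 : ∑ v ∈ N.inner, ∑ e ∈ N.edgesAt v, b e * N.normal e v * F e v ^ 2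
      = ∑ v ∈ N.inner, ∑ e ∈ N.edgesIn b v, |b e * N.normal e v| * |F e v - c v| ^ 2 := by
    refine Finset.sum_congr rfl fun v hv => ?_
    have hm := hmix v (Finset.mem_union_left _ hv)
    -- Let `m` be the total inflow. By mixing, the expanded square is `∑ b n F² - m c²`, and `-m c²`
    -- is exactly the contribution of the outgoing edges.
    have e1 : ∑ e ∈ N.edgesIn b v, |b e * N.normal e v| * |F e v - c v| ^ 2
        = ∑ e ∈ N.edgesIn b v, b e * N.normal e v * F e v ^ 2
          - 2 * c v * ∑ e ∈ N.edgesIn b v, b e * N.normal e v * F e v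
          + c v * ∑ e ∈ N.edgesIn b v, b e * N.normal e v * c v := by
      rw [Finset.mul_sum, Finset.mul_sum, ← Finset.sum_sub_distrib, ← Finset.sum_add_distrib]
      refine Finset.sum_congr rfl fun e he => ?_
      rw [sq_abs, abs_of_pos ((mem_edgesIn b).1 he)]
      ring
    rw [e1, ← hm, sum_edgesAt_eq_in_add_out,
      Finset.sum_congr (s₁ := N.edgesOut b v) rfl fun e he => by rw [hout v e he],
      ← Finset.sum_mul, ← Finset.sum_mul, sum_edgesOut_eq hflow hv]
    ring
  rw [sum_edges_eq_sum_vertices b fun e v => F e v ^ 2, sum_vertices hb, h1, h2, h3]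
  ring

end Vertices

end Network

end TransportNetwork

/-! ### Balance laws on the network and uniqueness. -/

namespace TransportNetwork

namespace Network

variable {V E : Type*} {N : Network V E}

theorem val_sub [DecidableEq V] (u w : N.H1pw) (e : E) (v : V) :
    N.val (u - w) e v = N.val u e v - N.val w e v := by
  refine H1.rep_sub (N.len_pos e) (u e) (w e) ?_
  split_ifs
  · exact ⟨(N.len_pos e).le, le_rfl⟩
  · exact ⟨le_rfl, (N.len_pos e).le⟩

variable [Fintype E]

theorem hasDerivWithinAt_edge {u : ℝ → N.H1pw} {D : N.L2net} {S : Set ℝ} {t : ℝ}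
    (hu : HasDerivWithinAt (fun s => N.toL2net (u s)) D S t) (e : E) :
    HasDerivWithinAt (fun s => (u s e).toL2) (D e) S t :=
  (PiLp.proj 2 (𝕜 := ℝ) (fun e : E => L2 (N.len e)) e).hasFDerivAt.comp_hasDerivWithinAt t hu

theorem hasDerivWithinAt_mass [DecidableEq V] {a : N.H1pw} {b : E → ℝ} {u : ℝ → N.H1pw}
    {D : N.L2net} {S : Set ℝ} {t : ℝ}
    (hu : HasDerivWithinAt (fun s => N.toL2net (u s)) D S t)
    (htr : ∀ e, ∀ᵐ x ∂(volume.restrict (Ioo 0 (N.len e))),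
      (a e).toL2 x * D e x + (b e • u t e : H1 (N.len e)).wderiv x = 0) :
    HasDerivWithinAt (fun s => N.mass a (u s))
      (-∑ e, b e * (N.val (u t) e (N.tgt e) - N.val (u t) e (N.src e))) S t := by
  simp only [val_tgt, val_src, ← Finset.sum_neg_distrib]
  exact HasDerivWithinAt.fun_sum fun e _ =>
    hasDerivWithinAt_edge_mass (N.len_pos e) (hasDerivWithinAt_edge hu e) (htr e)

theorem hasDerivWithinAt_energy [DecidableEq V] {a : N.H1pw} {b : E → ℝ} {u : ℝ → N.H1pw}
    {D : N.L2net} {S : Set ℝ} {t : ℝ}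
    (ha : ∀ e, ∀ᵐ x ∂(volume.restrict (Ioo 0 (N.len e))), 0 ≤ (a e).toL2 x)
    (hu : HasDerivWithinAt (fun s => N.toL2net (u s)) D S t)
    (htr : ∀ e, ∀ᵐ x ∂(volume.restrict (Ioo 0 (N.len e))),
      (a e).toL2 x * D e x + (b e • u t e : H1 (N.len e)).wderiv x = 0) :
    HasDerivWithinAt (fun s => N.energy a (u s))
      (-∑ e, b e * (N.val (u t) e (N.tgt e) ^ 2 - N.val (u t) e (N.src e) ^ 2)) S t := by
  simp only [val_tgt, val_src, ← Finset.sum_neg_distrib]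
  exact HasDerivWithinAt.fun_sum fun e _ =>
    hasDerivWithinAt_edge_energy (N.len_pos e) (hasDerivWithinAt_edge hu e) (htr e) (ha e)

theorem eq_zero_of_energy_nonpos {a u : N.H1pw}
    (ha : ∀ e, ∀ᵐ x ∂(volume.restrict (Ioo 0 (N.len e))), 0 < (a e).toL2 x)
    (h : N.energy a u ≤ 0) : u = 0 := by
  have hnn : ∀ e ∈ Finset.univ,
      0 ≤ ∫ x in Ioo 0 (N.len e), (Real.sqrt ((a e).toL2 x) * (u e).toL2 x) ^ 2 :=
    fun e _ => integral_nonneg fun x => sq_nonneg _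
  have h0 := (Finset.sum_eq_zero_iff_of_nonneg hnn).1 (le_antisymm h (Finset.sum_nonneg hnn))
  apply PiLp.ext
  intro e
  apply H1.ext_toL2
  have he := h0 e (Finset.mem_univ e)
  obtain ⟨M, hM⟩ := (a e).exists_mulL (N.len_pos e)
  have hi : Integrable (fun x => (Real.sqrt ((a e).toL2 x) * (u e).toL2 x) ^ 2)
      (volume.restrict (Ioo 0 (N.len e))) := by
    refine (integrable_mul_L2 (u e).toL2 (M (u e).toL2)).congr ?_
    filter_upwards [ha e, hM (u e).toL2] with x h1 h2
    rw [h2, mul_pow, Real.sq_sqrt h1.le]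
    ring
  rw [integral_eq_zero_iff_of_nonneg (fun x => sq_nonneg _) hi] at he
  refine (Lp.eq_zero_iff_ae_eq_zero (f := (u e).toL2)).2 ?_
  filter_upwards [he, ha e] with x h1 h2
  have h3 := pow_eq_zero_iff (two_ne_zero) |>.1 h1
  exact (mul_eq_zero.1 h3).resolve_left (Real.sqrt_pos.2 h2).ne'

namespace IsSolution

variable [Fintype V] [DecidableEq V] {a : N.H1pw} {b : E → ℝ} {T : ℝ} {u₀ : N.H1pw}
  {g : N.inflow b → H1 T} {u w : ℝ → N.H1pw} {uhat what : ℝ → V → ℝ}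

theorem hasDerivWithinAt (h : N.IsSolution a b T u₀ g u uhat) {t : ℝ} (ht : t ∈ Icc 0 T) :
    HasDerivWithinAt (fun s => N.toL2net (u s))
      (derivWithin (fun s => N.toL2net (u s)) (Icc 0 T) t) (Icc 0 T) t :=
  (h.contDiff_L2.differentiableOn one_ne_zero t ht).hasDerivWithinAt

theorem out_cond_sub (hw : N.IsSolution a b T u₀ g w what) (hu : N.IsSolution a b T u₀ g u uhat)
    {t : ℝ} (ht : t ∈ Ioc 0 T) : N.OutCond b (w t - u t) (what t - uhat t) := by
  intro v e he
  rw [val_sub, hw.out_cond t ht v e he, hu.out_cond t ht v e he, Pi.sub_apply]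

theorem mix_cond_sub (hw : N.IsSolution a b T u₀ g w what) (hu : N.IsSolution a b T u₀ g u uhat)
    {t : ℝ} (ht : t ∈ Icc 0 T) : N.MixCond b (w t - u t) (what t - uhat t) := by
  intro v hv
  simp only [val_sub, Pi.sub_apply, mul_sub, Finset.sum_sub_distrib]
  rw [hw.mix_cond t ht v hv, hu.mix_cond t ht v hv]

theorem transport_sub (hw : N.IsSolution a b T u₀ g w what) (hu : N.IsSolution a b T u₀ g u uhat)
    {t : ℝ} (ht : t ∈ Ioc 0 T) (e : E) :
    ∀ᵐ x ∂(volume.restrict (Ioo 0 (N.len e))),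
      (a e).toL2 x * (derivWithin (fun s => N.toL2net (w s)) (Icc 0 T) t
          - derivWithin (fun s => N.toL2net (u s)) (Icc 0 T) t) e x
        + (b e • (w t - u t) e : H1 (N.len e)).wderiv x = 0 := by
  have e1 : (b e • (w t - u t) e : H1 (N.len e)).wderiv
      = (b e • w t e : H1 (N.len e)).wderiv - (b e • u t e : H1 (N.len e)).wderiv := by
    have : (b e • (w t - u t) e : H1 (N.len e)) = b e • w t e - b e • u t e := smul_sub _ _ _
    rw [this]
    rfl
  rw [e1, PiLp.sub_apply]
  filter_upwards [hw.transport t ht e, hu.transport t ht e, Lp.coeFn_sub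
    ((derivWithin (fun s => N.toL2net (w s)) (Icc 0 T) t) e)
    ((derivWithin (fun s => N.toL2net (u s)) (Icc 0 T) t) e),
    Lp.coeFn_sub (b e • w t e : H1 (N.len e)).wderiv (b e • u t e : H1 (N.len e)).wderiv]
    with x h1 h2 h3 h4
  rw [h3, h4, Pi.sub_apply, Pi.sub_apply]
  linarith

/-- Solutions are unique. -/
theorem unique (ha : ∀ e, ∀ᵐ x ∂(volume.restrict (Ioo 0 (N.len e))), 0 < (a e).toL2 x)
    (hflow : ∀ v ∈ N.inner, ∑ e ∈ N.edgesAt v, b e * N.normal e v = 0)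
    (hb : ∀ v, ∃ e ∈ N.edgesAt v, b e ≠ 0)
    (hw : N.IsSolution a b T u₀ g w what) (hu : N.IsSolution a b T u₀ g u uhat) :
    EqOn w u (Icc 0 T) ∧ EqOn what uhat (Icc 0 T) := by
  have hd : ∀ t ∈ Icc 0 T, HasDerivWithinAt (fun s => N.toL2net (w s - u s))
      (derivWithin (fun s => N.toL2net (w s)) (Icc 0 T) t
        - derivWithin (fun s => N.toL2net (u s)) (Icc 0 T) t) (Icc 0 T) t := fun t ht =>
    (hw.hasDerivWithinAt ht).sub (hu.hasDerivWithinAt ht)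
  have hinf : ∀ t ∈ Icc 0 T, ∀ v ∈ N.inflow b, (what t - uhat t) v = 0 := by
    intro t ht v hv
    have h1 := hw.inflow_cond t ht ⟨v, hv⟩
    have h2 := hu.inflow_cond t ht ⟨v, hv⟩
    simp only at h1 h2
    rw [Pi.sub_apply, h1, h2, sub_self]
  -- A solution satisfies the equation and the outflow condition only for `t > 0`; the initial time
  -- is reached through continuity of the energy.
  have hE : ∀ t ∈ Ioc 0 T, ∃ r ≤ 0,
      HasDerivWithinAt (fun s => N.energy a (w s - u s)) r (Icc 0 T) t := by
    intro t ht
    refine ⟨_, ?_, hasDerivWithinAt_energy (fun e => (ha e).mono fun x hx => hx.le)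
      (hd t (Ioc_subset_Icc_self ht)) (hw.transport_sub hu ht)⟩
    rw [sum_flux_sq_eq hb hflow (F := fun e v => N.val (w t - u t) e v)
      (hw.out_cond_sub hu ht) (hw.mix_cond_sub hu (Ioc_subset_Icc_self ht)),
      Finset.sum_eq_zero (s := N.inflow b)]
    · have h1 : 0 ≤ ∑ v ∈ N.outflow b, ∑ e ∈ N.edgesAt v,
          |b e * N.normal e v| * |N.val (w t - u t) e v| ^ 2 :=
        Finset.sum_nonneg fun v _ => Finset.sum_nonneg fun e _ => by positivity
      have h2 : 0 ≤ ∑ v ∈ N.inner, ∑ e ∈ N.edgesIn b v,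
          |b e * N.normal e v| * |N.val (w t - u t) e v - (what t - uhat t) v| ^ 2 :=
        Finset.sum_nonneg fun v _ => Finset.sum_nonneg fun e _ => by positivity
      linarith
    · intro v hv
      rw [hinf t (Ioc_subset_Icc_self ht) v hv]
      simp
  have hz : ∀ z : N.H1pw, z = 0 → N.energy a z = 0 := by
    rintro _ rfl
    refine Finset.sum_eq_zero fun e _ => integral_eq_zero_of_ae ?_
    filter_upwards [Lp.coeFn_zero ℝ 2 (volume.restrict (Ioo (0 : ℝ) (N.len e)))] with x hx
    have : (((0 : N.H1pw) e).toL2 : ℝ → ℝ) x = 0 := hx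
    show (_ * (((0 : N.H1pw) e).toL2 : ℝ → ℝ) x) ^ 2 = 0
    rw [this, mul_zero, sq, mul_zero]
  have hcont : ContinuousOn (fun s => N.energy a (w s - u s)) (Icc 0 T) := by
    refine continuousOn_finsetSum _ fun e _ t ht => ?_
    obtain ⟨M, hM⟩ := (a e).exists_mulL (N.len_pos e)
    have h1 := (hasDerivWithinAt_edge (hd t ht) e).continuousWithinAt
    have h2 : ContinuousWithinAt (fun s => Inner.inner ℝ ((w s - u s) e).toL2
      (M ((w s - u s) e).toL2)) (Icc 0 T) t := h1.inner (M.continuous.continuousAt.comp_continuousWithinAt h1)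
    refine h2.congr_of_eventuallyEq (Filter.Eventually.of_forall fun s => ?_) ?_ <;>
    · beta_reduce
      rw [inner_L2_eq]
      apply integral_congr_ae
      filter_upwards [ha e, hM ((w _ - u _) e).toL2] with x h1 h2
      rw [h2, mul_pow, Real.sq_sqrt h1.le]
      ring
  have hanti : AntitoneOn (fun s => N.energy a (w s - u s)) (Icc 0 T) := by
    refine antitoneOn_of_deriv_nonpos (convex_Icc 0 T) hcont ?_ ?_
    · intro t ht
      rw [interior_Icc] at ht
      obtain ⟨r, -, hr⟩ := hE t (Ioo_subset_Ioc_self ht)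
      exact (hr.mono interior_subset).differentiableWithinAt
    · intro t ht
      rw [interior_Icc] at ht
      obtain ⟨r, hr0, hr⟩ := hE t (Ioo_subset_Ioc_self ht)
      rw [(hr.hasDerivAt (Icc_mem_nhds ht.1 ht.2)).deriv]
      exact hr0
  have hu0 : ∀ t ∈ Icc 0 T, w t - u t = 0 := by
    intro t ht
    apply eq_zero_of_energy_nonpos ha
    exact (hanti ⟨le_rfl, ht.1.trans ht.2⟩ ht ht.1).trans
      (hz (w 0 - u 0) (by rw [hw.initial, hu.initial, sub_self])).le
  -- The vertex values are prescribed at inflow vertices; elsewhere the mixing condition determines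
  -- them, as the total inflow is positive.
  refine ⟨fun t ht => sub_eq_zero.1 (hu0 t ht), fun t ht => funext fun v => ?_⟩
  rw [← sub_eq_zero, ← Pi.sub_apply]
  rcases inflow_or hb v with hv | hv
  · exact hinf t ht v hv
  · have h1 := hw.mix_cond_sub hu ht v hv
    rw [hu0 t ht, ← Finset.sum_mul] at h1
    have h2 : ∑ e ∈ N.edgesIn b v, b e * N.normal e v * N.val (0 : N.H1pw) e v = 0 := by
      refine Finset.sum_eq_zero fun e _ => ?_
      rw [← sub_self (0 : N.H1pw), val_sub, sub_self, mul_zero]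
    rw [h2] at h1
    exact (mul_eq_zero.1 h1).resolve_left (sum_edgesIn_pos hb hflow hv).ne'

end IsSolution

end Network

end TransportNetwork

/-! ### Existence: delay equations at the vertices and assembly of the waves. -/

namespace TransportNetwork

theorem isBiLip_sub_const (τ : ℝ) : IsBiLip (fun t => t - τ) fun _ => 1 where
  hasDerivAt x := (hasDerivAt_id x).sub_const τ
  cont := continuous_const
  sign := Or.inl fun _ => one_pos
  lower := ⟨1, one_pos, by simp⟩
  upper := ⟨1, by simp⟩

/-- A system of delay equations is solvable up to every time, by the method of steps. -/
theorem exists_delay_solution {V E : Type*} [Finite E] (P : Finset V) (G : P → ℝ → ℝ)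
    (hG : ∀ v, ∃ ψ, HasL2Deriv (G v) ψ) (In : V → Finset E) (wt : V → E → ℝ) (up : E → V)
    (q : E → ℝ → ℝ) (hq : ∀ e, ∃ ψ, HasL2Deriv (q e) ψ) (τ : E → ℝ) (hτ : ∀ e, 0 < τ e)
    (c : V → ℝ) (hqc : ∀ e, q e 0 = c (up e)) (hGc : ∀ v : P, G v 0 = c v)
    (hwc : ∀ v ∉ P, ∑ e ∈ In v, wt v e * q e (-τ e) = c v) (T : ℝ) :
    ∃ y : V → ℝ → ℝ, (∀ v, ∃ ψ, HasL2Deriv (y v) ψ) ∧ (∀ v, y v 0 = c v) ∧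
      (∀ v : P, ∀ t ∈ Icc 0 T, y v t = G v t) ∧
      ∀ v ∉ P, ∀ t ∈ Icc 0 T, y v t
        = ∑ e ∈ In v, wt v e * (if t - τ e ≤ 0 then q e (t - τ e) else y (up e) (t - τ e)) := by
  classical
  -- The solution is a fixed point of `Φ` on `[0, T]`.
  let Φ : (V → ℝ → ℝ) → V → ℝ → ℝ := fun y v t =>
    if h : v ∈ P then G ⟨v, h⟩ t else
      ∑ e ∈ In v, wt v e * (if t - τ e ≤ 0 then q e (t - τ e) else y (up e) (t - τ e))
  obtain ⟨δ, hδ, hδτ⟩ : ∃ δ > 0, ∀ e, δ ≤ τ e := by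
    rcases isEmpty_or_nonempty E with hE | hE
    · exact ⟨1, one_pos, fun e => hE.elim e⟩
    · obtain ⟨e, he⟩ := Finite.exists_min τ
      exact ⟨τ e, hτ e, he⟩
  have hΦ : ∀ y : V → ℝ → ℝ, (∀ v, ∃ ψ, HasL2Deriv (y v) ψ) → (∀ v, y v 0 = c v) →
      (∀ v, ∃ ψ, HasL2Deriv (Φ y v) ψ) ∧ ∀ v, Φ y v 0 = c v := by
    intro y hy hyc
    refine ⟨fun v => ?_, fun v => ?_⟩
    · by_cases h : v ∈ P
      · simpa only [Φ, h, dite_true] using hG ⟨v, h⟩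
      · simp only [Φ, h, dite_false]
        refine HasL2Deriv.exists_sum _ _ fun e _ => ?_
        obtain ⟨ψ₁, h₁⟩ := hq e
        obtain ⟨ψ₂, h₂⟩ := hy (up e)
        exact ⟨_, ((h₁.glue h₂ (by rw [hqc, hyc])).comp (isBiLip_sub_const (τ e))).const_mul _⟩
    · by_cases h : v ∈ P
      · simpa only [Φ, h, dite_true] using hGc ⟨v, h⟩
      · simp only [Φ, h, dite_false]
        rw [← hwc v h]
        refine Finset.sum_congr rfl fun e _ => ?_
        rw [zero_sub, if_pos (neg_nonpos.2 (hτ e).le)]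
  -- On `[0, (n+1)δ)` the map `Φ` reads its argument at positive times only on `[0, nδ)`, so each
  -- application extends the range by `δ`. The strict bound makes `n = 0` vacuous.
  have key : ∀ n : ℕ, ∃ y : V → ℝ → ℝ, (∀ v, ∃ ψ, HasL2Deriv (y v) ψ) ∧ (∀ v, y v 0 = c v) ∧
      ∀ v t, 0 ≤ t → t < n * δ → y v t = Φ y v t := by
    intro n
    induction n with
    | zero =>
      refine ⟨fun v _ => c v, fun v => ⟨_, HasL2Deriv.const _⟩, fun _ => rfl, fun v t h1 h2 => ?_⟩
      simp only [Nat.cast_zero, zero_mul] at h2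
      exact absurd h2 (not_lt.2 h1)
    | succ n ih =>
      obtain ⟨y, hy, hyc, hfix⟩ := ih
      refine ⟨Φ y, (hΦ y hy hyc).1, (hΦ y hy hyc).2, fun v t _ h2 => ?_⟩
      push_cast at h2
      by_cases h : v ∈ P
      · simp only [Φ, h, dite_true]
      · have e1 : Φ y v t = ∑ e ∈ In v, wt v e *
            (if t - τ e ≤ 0 then q e (t - τ e) else y (up e) (t - τ e)) := by
          simp only [Φ, h, dite_false]
        have e2 : Φ (Φ y) v t = ∑ e ∈ In v, wt v e *
            (if t - τ e ≤ 0 then q e (t - τ e) else Φ y (up e) (t - τ e)) := by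
          simp only [Φ, h, dite_false]
        rw [e1, e2]
        refine Finset.sum_congr rfl fun e _ => ?_
        split_ifs with hle
        · rfl
        · rw [hfix (up e) (t - τ e) (le_of_not_ge hle) (by linarith [hδτ e])]
  obtain ⟨n, hn⟩ := exists_nat_gt (T / δ)
  obtain ⟨y, hy, hyc, hfix⟩ := key n
  have hT : T < n * δ := (div_lt_iff₀ hδ).1 hn
  refine ⟨y, hy, hyc, fun v t ht => ?_, fun v hv t ht => ?_⟩
  · rw [hfix v t ht.1 (ht.2.trans_lt hT)]
    simp only [Φ, v.2, dite_true]
  · rw [hfix v t ht.1 (ht.2.trans_lt hT)]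
    simp only [Φ, hv, dite_false]

namespace Network

variable {V E : Type*} {N : Network V E}

/-- The vertex at which the flow enters an edge. -/
noncomputable def upstream (N : Network V E) (b : E → ℝ) (e : E) : V :=
  if 0 < b e then N.src e else N.tgt e

/-- The coordinate of the point at which the flow enters an edge. -/
noncomputable def entry (N : Network V E) (b : E → ℝ) (e : E) : ℝ :=
  if 0 < b e then 0 else N.len e

/-- The coordinate of the point at which the flow leaves an edge. -/
noncomputable def exit (N : Network V E) (b : E → ℝ) (e : E) : ℝ :=
  if 0 < b e then N.len e else 0

theorem entry_mem (b : E → ℝ) (e : E) : N.entry b e ∈ Icc 0 (N.len e) := by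
  have := (N.len_pos e).le
  unfold entry
  split_ifs <;> simp [this]

theorem exit_mem (b : E → ℝ) (e : E) : N.exit b e ∈ Icc 0 (N.len e) := by
  have := (N.len_pos e).le
  unfold exit
  split_ifs <;> simp [this]

section

variable [DecidableEq V]

theorem eq_src_or_tgt {b : E → ℝ} {e : E} {v : V} (h : b e * N.normal e v ≠ 0) :
    v = N.src e ∨ v = N.tgt e := by
  by_contra hcon
  rw [not_or] at hcon
  exact h (by simp [normal, hcon.1, hcon.2])

theorem val_of_out {b : E → ℝ} {e : E} {v : V} (h : b e * N.normal e v < 0) :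
    b e ≠ 0 ∧ N.upstream b e = v ∧ ∀ u : N.H1pw, N.val u e v = (u e).rep (N.entry b e) := by
  rcases N.eq_src_or_tgt h.ne with rfl | rfl
  · rw [normal_src] at h
    have hb : 0 < b e := by linarith
    refine ⟨hb.ne', by simp [upstream, hb], fun u => ?_⟩
    rw [val_src, entry, if_pos hb]
  · rw [normal_tgt] at h
    have hb : b e < 0 := by linarith
    refine ⟨hb.ne, by simp [upstream, hb.not_gt], fun u => ?_⟩
    rw [val_tgt, entry, if_neg hb.not_gt]

theorem val_of_in {b : E → ℝ} {e : E} {v : V} (h : 0 < b e * N.normal e v) :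
    b e ≠ 0 ∧ ∀ u : N.H1pw, N.val u e v = (u e).rep (N.exit b e) := by
  rcases N.eq_src_or_tgt h.ne' with rfl | rfl
  · rw [normal_src] at h
    have hb : b e < 0 := by linarith
    refine ⟨hb.ne, fun u => ?_⟩
    rw [val_src, exit, if_neg hb.not_gt]
  · rw [normal_tgt] at h
    have hb : 0 < b e := by linarith
    refine ⟨hb.ne', fun u => ?_⟩
    rw [val_tgt, exit, if_pos hb]

theorem mul_normal_upstream_neg {b : E → ℝ} {e : E} (hb : b e ≠ 0) :
    b e * N.normal e (N.upstream b e) < 0 := by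
  unfold upstream
  split_ifs with h
  · rw [normal_src]; linarith
  · rw [normal_tgt]; linarith [lt_of_le_of_ne (not_lt.1 h) hb]

end

/-- Travel times and entrance data on an edge. -/
theorem exists_edge_data {a : N.H1pw} {a₀ : ℝ} (ha₀ : 0 < a₀)
    (ha : ∀ e, ∀ᵐ x ∂(volume.restrict (Ioo 0 (N.len e))), a₀ ≤ (a e).toL2 x) (b : E → ℝ)
    (u₀ : N.H1pw) (c : V → ℝ)
    (hc : ∀ e, b e ≠ 0 → (u₀ e).rep (N.entry b e) = c (N.upstream b e)) (e : E) :
    ∃ (κ κ' q ψ : ℝ → ℝ) (τ : ℝ), IsBiLip κ κ' ∧ HasL2Deriv q ψ ∧ 0 < τ ∧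
      q 0 = c (N.upstream b e) ∧ (b e ≠ 0 →
        ((a e).toL2 =ᵐ[volume.restrict (Ioo (0 : ℝ) (N.len e))] fun x => b e * κ' x) ∧
        (∀ x ∈ Icc 0 (N.len e), 0 ≤ κ x ∧ q (-κ x) = (u₀ e).rep x) ∧
        κ (N.entry b e) = 0 ∧ κ (N.exit b e) = τ) := by
  by_cases hb : b e = 0
  · exact ⟨_, _, _, _, 1, isBiLip_sub_const 0, HasL2Deriv.const (c (N.upstream b e)), one_pos, rfl,
      fun h => absurd hb h⟩
  have hL := N.len_pos e
  obtain ⟨κ, κ', q, ψ, hκ, hκ0, hmono, hae, hq, hqu⟩ :=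
    exists_travel_time hL ha₀ (ha e) hb (N.entry b e) (u₀ e)
  -- As `b κ` increases and `κ` vanishes at the entry, `κ` is nonnegative on the edge for either
  -- sign of `b`.
  have hpos : 0 < κ (N.exit b e) ∧ ∀ x ∈ Icc 0 (N.len e), 0 ≤ κ x := by
    have hκ0' := hκ0
    rcases lt_or_gt_of_ne hb with h | h
    · rw [entry, if_neg h.not_gt] at hκ0'
      rw [exit, if_neg h.not_gt]
      refine ⟨?_, fun x hx => ?_⟩
      · have h1 : b e * κ 0 < b e * κ (N.len e) := hmono hL
        rw [hκ0', mul_zero] at h1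
        exact pos_of_mul_neg_right h1 h.le
      · have h1 : b e * κ x ≤ b e * κ (N.len e) := hmono.monotone hx.2
        rw [hκ0', mul_zero] at h1
        exact nonneg_of_mul_nonpos_right h1 h
    · rw [entry, if_pos h] at hκ0'
      rw [exit, if_pos h]
      refine ⟨?_, fun x hx => ?_⟩
      · have h1 : b e * κ 0 < b e * κ (N.len e) := hmono hL
        rw [hκ0', mul_zero] at h1
        exact pos_of_mul_pos_right h1 h.le
      · have h1 : b e * κ 0 ≤ b e * κ x := hmono.monotone hx.1
        rw [hκ0', mul_zero] at h1
        exact nonneg_of_mul_nonneg_right h1 h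
  refine ⟨κ, κ', q, ψ, κ (N.exit b e), hκ, hq, hpos.1, ?_, fun _ => ⟨hae, fun x hx =>
    ⟨hpos.2 x hx, hqu x hx⟩, hκ0, rfl⟩⟩
  rw [← hc e hb, ← hqu _ (N.entry_mem b e), hκ0, neg_zero]

theorem hasDerivAt_toL2net [Fintype E] {u : ℝ → N.H1pw} {D : ∀ e, L2 (N.len e)} {t : ℝ}
    (h : ∀ e, HasDerivAt (fun s => (u s e).toL2) (D e) t) :
    HasDerivAt (fun s => N.toL2net (u s)) (WithLp.toLp 2 D) t := by
  exact (PiLp.hasFDerivAt_toLp (𝕜 := ℝ) 2 fun e => (u t e).toL2).comp_hasDerivAt t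
    (hasDerivAt_pi.2 h)

/-- Existence of a solution that solves the transport equation up to the initial time. -/
theorem exists_solution [Fintype V] [DecidableEq V] [Fintype E] {a : N.H1pw} {b : E → ℝ}
    {a₀ : ℝ} (ha₀ : 0 < a₀)
    (ha : ∀ e, ∀ᵐ x ∂(volume.restrict (Ioo 0 (N.len e))), a₀ ≤ (a e).toL2 x)
    (hflow : ∀ v ∈ N.inner, ∑ e ∈ N.edgesAt v, b e * N.normal e v = 0)
    (hb : ∀ v, ∃ e ∈ N.edgesAt v, b e ≠ 0) {T : ℝ} (hT : 0 < T)
    {u₀ : N.H1pw} {g : N.inflow b → H1 T} {uhat₀ : V → ℝ} (hout₀ : N.OutCond b u₀ uhat₀)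
    (hin₀ : N.InflowCond b (fun v => (g v).rep 0) uhat₀) (hmix₀ : N.MixCond b u₀ uhat₀) :
    ∃ (u : ℝ → N.H1pw) (uhat : ℝ → V → ℝ) (D : ℝ → N.L2net),
      N.IsSolution a b T u₀ g u uhat ∧ uhat 0 = uhat₀ ∧
      (∀ t, HasDerivAt (fun s => N.toL2net (u s)) (D t) t) ∧
      (∀ t e, ∀ᵐ x ∂(volume.restrict (Ioo 0 (N.len e))),
        (a e).toL2 x * D t e x + (b e • u t e : H1 (N.len e)).wderiv x = 0) ∧
      ∀ t ∈ Icc 0 T, N.OutCond b (u t) (uhat t) := by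
  have hc : ∀ e, b e ≠ 0 → (u₀ e).rep (N.entry b e) = uhat₀ (N.upstream b e) := by
    intro e he
    have h := mul_normal_upstream_neg (N := N) he
    rw [← (val_of_out h).2.2 u₀]
    exact hout₀ _ e ((mem_edgesOut b).2 h)
  choose κ κ' q ψ τ hκ hq hτ hqc hdata using exists_edge_data ha₀ ha b u₀ uhat₀ hc
  choose G hG hGae hGrep using fun v => (g v).exists_rep hT
  have hmem : ∀ v ∉ N.inflow b, v ∈ N.inner ∪ N.outflow b := fun v hv =>
    (inflow_or hb v).resolve_left hv
  have hnmem : ∀ v ∈ N.inner ∪ N.outflow b, v ∉ N.inflow b := by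
    intro v hv hv'
    rcases Finset.mem_union.1 hv with h | h
    · have h1 : v ∈ N.boundary := (Finset.mem_filter.1 hv').1
      simp only [boundary, Finset.mem_sdiff] at h1
      exact h1.2 h
    · exact Finset.disjoint_left.1 (disjoint_inflow_outflow hb) hv' h
  have hsum : ∀ v ∈ N.inner ∪ N.outflow b, (∑ e ∈ N.edgesIn b v, b e * N.normal e v) ≠ 0 :=
    fun v hv => (sum_edgesIn_pos hb hflow hv).ne'
  -- Dividing the mixing condition by the total inflow solves it for the vertex value, which gives
  -- the weights.
  obtain ⟨y, hy, hyc, hyG, hyd⟩ := exists_delay_solution (N.inflow b) G (fun v => ⟨_, hG v⟩)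
    (N.edgesIn b) (fun v e => (∑ e ∈ N.edgesIn b v, b e * N.normal e v)⁻¹ * (b e * N.normal e v))
    (N.upstream b) q (fun e => ⟨_, hq e⟩) τ hτ uhat₀ hqc
    (fun v => by rw [← hGrep v ⟨le_rfl, hT.le⟩]; exact (hin₀ v).symm)
    (fun v hv => by
      have hv' := hmem v hv
      have h1 := hmix₀ v hv'
      rw [← Finset.sum_mul] at h1
      simp only [mul_assoc]
      rw [← Finset.mul_sum, inv_mul_eq_iff_eq_mul₀ (hsum v hv'), h1]
      refine Finset.sum_congr rfl fun e he => ?_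
      obtain ⟨hbe, hval⟩ := val_of_in ((mem_edgesIn b).1 he)
      obtain ⟨-, hqu, -, hex⟩ := hdata e hbe
      rw [hval, ← (hqu _ (N.exit_mem b e)).2, hex, mul_assoc]) T
  choose χ hχ using hy
  -- The entering signal: initial values at times `≤ 0`, the upstream vertex value afterwards. The
  -- pieces agree at `0`, where both equal `uhat₀` at the upstream vertex.
  have hf := fun e => (hq e).glue (hχ (N.upstream b e)) (by rw [hqc, hyc])
  let u : ℝ → N.H1pw := fun t => WithLp.toLp 2 fun e =>
    if b e = 0 then u₀ e else edgeFlow (hf e) (hκ e) (N.len e) t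
  let D : ℝ → N.L2net := fun t => WithLp.toLp 2 fun e =>
    if b e = 0 then 0 else edgeFlowDeriv (hf e) (hκ e) (N.len e) t
  have hu0 : ∀ e, b e = 0 → ∀ t, u t e = u₀ e := fun e he t => if_pos he
  have hu1 : ∀ e, b e ≠ 0 → ∀ t, u t e = edgeFlow (hf e) (hκ e) (N.len e) t :=
    fun e he t => if_neg he
  have hD0 : ∀ e, b e = 0 → ∀ t, D t e = 0 := fun e he t => if_pos he
  have hD1 : ∀ e, b e ≠ 0 → ∀ t, D t e = edgeFlowDeriv (hf e) (hκ e) (N.len e) t :=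
    fun e he t => if_neg he
  have hderiv : ∀ t, HasDerivAt (fun s => N.toL2net (u s)) (D t) t := by
    refine fun t => hasDerivAt_toL2net fun e => ?_
    by_cases he : b e = 0
    · simp only [hu0 e he, if_pos he]
      exact hasDerivAt_const _ _
    · simp only [hu1 e he, if_neg he]
      exact hasDerivAt_edgeFlow (hf e) (hκ e) (N.len e) t
  have hDcont : Continuous D := by
    refine (PiLp.continuous_toLp 2 _).comp (continuous_pi fun e => ?_)
    by_cases he : b e = 0
    · simp only [if_pos he]
      exact continuous_const
    · simp only [if_neg he]
      exact continuous_edgeFlowDeriv (hf e) (hκ e)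
  have hucont : Continuous u := by
    refine (PiLp.continuous_toLp 2 _).comp (continuous_pi fun e => ?_)
    by_cases he : b e = 0
    · simp only [if_pos he]
      exact continuous_const
    · simp only [if_neg he]
      exact continuous_edgeFlow (hf e) (hκ e)
  have htr : ∀ t e, ∀ᵐ x ∂(volume.restrict (Ioo 0 (N.len e))),
      (a e).toL2 x * D t e x + (b e • u t e : H1 (N.len e)).wderiv x = 0 := by
    intro t e
    by_cases he : b e = 0
    · rw [hD0 e he]
      filter_upwards [H1.wderiv_smul_ae (b e) (u t e),
        Lp.coeFn_zero ℝ 2 (volume.restrict (Ioo (0 : ℝ) (N.len e)))] with x h1 h2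
      rw [h1, h2, he]
      simp
    · obtain ⟨hae, -⟩ := hdata e he
      rw [hD1 e he]
      filter_upwards [H1.wderiv_smul_ae (b e) (u t e), hae,
        wderiv_edgeFlow_ae (hf e) (hκ e) (N.len e) t,
        edgeFlowDeriv_ae (hf e) (hκ e) (N.len e) t] with x h1 h2 h3 h4
      rw [h1, hu1 e he, h2, h3, h4]
      ring
  have hout : ∀ t ∈ Icc 0 T, N.OutCond b (u t) (fun v => y v t) := by
    intro t ht v e he
    obtain ⟨hbe, hup, hval⟩ := val_of_out ((mem_edgesOut b).1 he)
    obtain ⟨-, -, hen, -⟩ := hdata e hbe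
    rw [hval, hu1 e hbe, rep_edgeFlow (hf e) (hκ e) (N.len_pos e) t (N.entry_mem b e)]
    simp only [hen, sub_zero, hup]
    -- The branch of nonpositive times occurs here only at `t = 0`.
    split_ifs with h
    · rw [le_antisymm h ht.1, hqc, hyc, hup]
    · rfl
  refine ⟨u, fun t v => y v t, D, ⟨?_, hucont.continuousOn, ?_, ?_, ?_, ?_, ?_, ?_⟩,
    funext hyc, hderiv, htr, hout⟩
  · refine ContDiff.contDiffOn (contDiff_one_iff_deriv.2 ⟨fun t => (hderiv t).differentiableAt, ?_⟩)
    rwa [show deriv (fun s => N.toL2net (u s)) = D from funext fun t => (hderiv t).deriv]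
  · exact (continuous_pi fun v => (hχ v).continuous).continuousOn
  · intro t ht e
    rw [(hderiv t).hasDerivWithinAt.derivWithin
      (uniqueDiffOn_Icc hT t (Ioc_subset_Icc_self ht))]
    exact htr t e
  · apply PiLp.ext
    intro e
    by_cases he : b e = 0
    · exact hu0 e he 0
    · obtain ⟨-, hqu, -⟩ := hdata e he
      rw [hu1 e he]
      refine H1.ext_toL2 (Lp.ext ?_)
      filter_upwards [toL2_edgeFlow_ae (hf e) (hκ e) (N.len e) 0,
        (u₀ e).toL2_ae_eq_rep (N.len_pos e), ae_restrict_mem measurableSet_Ioo] with x h1 h2 hx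
      obtain ⟨h3, h4⟩ := hqu x (Ioo_subset_Icc_self hx)
      rw [h1, h2, zero_sub, if_pos (neg_nonpos.2 h3), h4]
  · exact fun t ht => hout t (Ioc_subset_Icc_self ht)
  · intro t ht v
    simp only
    rw [hyG v t ht, hGrep v ht]
  · intro t ht v hv
    rw [← Finset.sum_mul]
    simp only
    rw [hyd v (hnmem v hv) t ht]
    simp only [mul_assoc]
    rw [← Finset.mul_sum, mul_inv_cancel_left₀ (hsum v hv)]
    refine Finset.sum_congr rfl fun e he => ?_
    obtain ⟨hbe, hval⟩ := val_of_in ((mem_edgesIn b).1 he)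
    obtain ⟨-, -, -, hex⟩ := hdata e hbe
    rw [hval, hu1 e hbe, rep_edgeFlow (hf e) (hκ e) (N.len_pos e) t (N.exit_mem b e)]
    simp only [hex]

end Network

end TransportNetwork

/-! ### The main theorem. -/

theorem theorem1 {V E : Type*} [Fintype V] [DecidableEq V] [Fintype E]
    (N : Network V E) (hN : N.Connected)
    (a : N.H1pw) (b : E → ℝ)
    (a₀ : ℝ) (ha₀ : 0 < a₀)
    (ha : ∀ e, ∀ᵐ x ∂(volume.restrict (Ioo 0 (N.len e))), a₀ ≤ (a e).toL2 x)
    (hflow : ∀ v ∈ N.inner, ∑ e ∈ N.edgesAt v, b e * N.normal e v = 0)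
    -- every vertex lies on an edge with nonzero flow
    (hb : ∀ v, ∃ e ∈ N.edgesAt v, b e ≠ 0)
    (T : ℝ) (hT : 0 < T)
    (u₀ : N.H1pw) (g : N.inflow b → H1 T) (hg : ∀ v, (g v).IsH2)
    (uhat₀ : V → ℝ)
    (hout₀ : N.OutCond b u₀ uhat₀)
    (hin₀ : N.InflowCond b (fun v => (g v).rep 0) uhat₀)
    (hmix₀ : N.MixCond b u₀ uhat₀) :
    ∃ (u : ℝ → N.H1pw) (uhat : ℝ → V → ℝ),
      N.IsSolution a b T u₀ g u uhat ∧
      uhat 0 = uhat₀ ∧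
      (∀ (w : ℝ → N.H1pw) (what : ℝ → V → ℝ), N.IsSolution a b T u₀ g w what →
        EqOn w u (Icc 0 T) ∧ EqOn what uhat (Icc 0 T)) ∧
      (∀ t ∈ Icc 0 T,
        HasDerivWithinAt (fun s => N.mass a (u s))
          (- ∑ v ∈ N.boundary, ∑ e ∈ N.edgesAt v, b e * N.normal e v * N.val (u t) e v)
          (Icc 0 T) t) ∧
      (∀ t ∈ Icc 0 T,
        HasDerivWithinAt (fun s => N.energy a (u s))
          (- (∑ v ∈ N.outflow b, ∑ e ∈ N.edgesAt v,
                |b e * N.normal e v| * |N.val (u t) e v| ^ 2)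
            + (∑ v : N.inflow b, ∑ e ∈ N.edgesAt v,
                |b e * N.normal e v| * |(g v).rep t| ^ 2)
            - (∑ v ∈ N.inner, ∑ e ∈ N.edgesIn b v,
                |b e * N.normal e v| * |N.val (u t) e v - uhat t v| ^ 2))
          (Icc 0 T) t) := by
  -- For the constructed solution `htr` and `hout` also hold at `t = 0`, which `IsSolution` does not
  -- record; hence both balance laws include the initial time.
  obtain ⟨u, uhat, D, hu, h0, hD, htr, hout⟩ :=
    Network.exists_solution ha₀ ha hflow hb hT hout₀ hin₀ hmix₀
  refine ⟨u, uhat, hu, h0, fun w what hw => hw.unique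
    (fun e => (ha e).mono fun x hx => ha₀.trans_le hx) hflow hb hu, fun t ht => ?_, fun t ht => ?_⟩
  · rw [← Network.sum_flux_eq hb hflow (F := fun e v => N.val (u t) e v) (hout t ht)
      (hu.mix_cond t ht)]
    exact Network.hasDerivWithinAt_mass (hD t).hasDerivWithinAt (htr t)
  · have hg : ∑ v : N.inflow b, ∑ e ∈ N.edgesAt v, |b e * N.normal e v| * |(g v).rep t| ^ 2
        = ∑ v ∈ N.inflow b, ∑ e ∈ N.edgesAt v, |b e * N.normal e v| * |uhat t v| ^ 2 := by
      rw [← Finset.sum_coe_sort (N.inflow b)]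
      exact Finset.sum_congr rfl fun v _ => by rw [hu.inflow_cond t ht v]
    rw [hg, ← Network.sum_flux_sq_eq hb hflow (F := fun e v => N.val (u t) e v) (hout t ht)
      (hu.mix_cond t ht)]
    exact Network.hasDerivWithinAt_energy (fun e => (ha e).mono fun x hx => ha₀.le.trans hx)
      (hD t).hasDerivWithinAt (htr t)
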